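/- Let $d\ge 1$ and let $\mu$ be a finite Borel measure on $\mathbb{R}^d$, with Fourier transform $\widehat\mu(z)=\int e^{-2\pi i z\cdot x}\,d\mu(x)$ and (closed) support $\mathrm{spt}(\mu)$. Define the Fourier dimension of $\mu$ by $$\dim_{\mathrm F}\mu=\sup\{s\ge 0:\ \exists C>0\ \forall z\neq 0,\ |\widehat\mu(z)|\le C|z|^{-s/2}\}\in[0,\infty].$$ For $s\ge 0$ and $\theta\in(0,1]$ put $$\mathcal J_{s,\theta}(\mu)=\Big(\int_{\mathbb{R}^d}|\widehat\mu(z)|^{2/\theta}|z|^{s/\theta-d}\,dz\Big)^{\theta},\qquad \mathcal J_{s,0}(\mu)=\sup_{z\in\mathbb{R}^d}|\widehat\mu(z)|^2|z|^s,$$ and, for $\theta\in[0,1]$, let $\dim_{\mathrm F}^\theta\mu=\sup\{s\ge0:\mathcal J_{s,\theta}(\mu)<\infty\}\in[0,\infty]$, where $\sup\emptyset=0$. For $X\subseteq\mathbb{R}^d$ let $$\dim_{\mathrm F}X=\sup_\mu\min\{\dim_{\mathrm F}\mu,d\},\qquad \dim_{\mathrm F}^\theta X=\sup_\mu\min\{\dim_{\mathrm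 F}^\theta\mu,d\},$$ both suprema being over all nonzero finite Borel measures $\mu$ on $\mathbb{R}^d$ with $\mathrm{spt}(\mu)\subseteq X$. Let $\dim_{\mathrm H}$ denote Hausdorff dimension. **Theorem.** Let $X\subseteq\mathbb{R}^d$ be non-empty. Then $$\dim_{\mathrm F}^\theta X\le \dim_{\mathrm F}X+d\Big(1+\frac{\dim_{\mathrm F}X}{2}\Big)\theta\qquad\text{for all }\theta\in[0,1].$$ Moreover, the function $\theta\mapsto\dim_{\mathrm F}^\theta X$ is Lipschitz continuous on $[0,1]$, $\dim_{\mathrm F}^0X=\dim_{\mathrm F}X$, and, if $X$ is a Borel set, $\dim_{\mathrm F}^1X=\dim_{\mathrm H}X$. -/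

import Mathlib

open MeasureTheory Set
open scoped ENNReal NNReal

/-- The Fourier transform `z ↦ ∫ exp (-2πi z·x) dμ(x)` of a measure on `ℝ^d`. -/
noncomputable def fourierTransformMeasure {d : ℕ} (μ : Measure (EuclideanSpace ℝ (Fin d)))
    (z : EuclideanSpace ℝ (Fin d)) : ℂ :=
  ∫ x, Complex.exp (-2 * Real.pi * Complex.I * (inner ℝ z x : ℝ)) ∂μ

/-- The Fourier dimension of a measure: the supremum of all `s ≥ 0` such that
`|μ̂(z)| ≤ C |z|^(-s/2)` for some constant `C` and all `z ≠ 0`. -/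
noncomputable def fourierDimMeasure {d : ℕ} (μ : Measure (EuclideanSpace ℝ (Fin d))) : ℝ≥0∞ :=
  ⨆ (s : ℝ≥0) (_ : ∃ C : ℝ, ∀ z : EuclideanSpace ℝ (Fin d), z ≠ 0 →
    ‖fourierTransformMeasure μ z‖ ≤ C * ‖z‖ ^ (-(s : ℝ) / 2)), (s : ℝ≥0∞)

/-- The Fourier dimension of a set `X ⊆ ℝ^d`: the supremum of `min {dim_F μ, d}` over all nonzero
finite Borel measures `μ` whose (closed) support is contained in `X`. -/
noncomputable def fourierDimSet {d : ℕ} (X : Set (EuclideanSpace ℝ (Fin d))) : ℝ≥0∞ :=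
  ⨆ (μ : Measure (EuclideanSpace ℝ (Fin d))) (_ : IsFiniteMeasure μ ∧ μ ≠ 0 ∧ μ.support ⊆ X),
    min (fourierDimMeasure μ) (d : ℝ≥0∞)

/-- The energy `J_{s,θ}(μ) = (∫ |μ̂(z)|^(2/θ) |z|^(s/θ - d) dz)^θ` for `θ ≠ 0`, and
`J_{s,0}(μ) = sup_z |μ̂(z)|^2 |z|^s`, with values in `[0,∞]`. -/
noncomputable def fourierEnergy {d : ℕ} (s θ : ℝ)
    (μ : Measure (EuclideanSpace ℝ (Fin d))) : ℝ≥0∞ :=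
  if θ = 0 then
    ⨆ z : EuclideanSpace ℝ (Fin d), ‖fourierTransformMeasure μ z‖ₑ ^ (2 : ℝ) * ‖z‖ₑ ^ s
  else
    (∫⁻ z : EuclideanSpace ℝ (Fin d),
      ‖fourierTransformMeasure μ z‖ₑ ^ (2 / θ) * ‖z‖ₑ ^ (s / θ - d)) ^ θ

/-- The Fourier spectrum of a measure at `θ`: the supremum (in `[0,∞]`, with `sup ∅ = 0`) of all
`s ≥ 0` with `J_{s,θ}(μ) < ∞`. -/
noncomputable def fourierSpectrumMeasure {d : ℕ} (θ : ℝ)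
    (μ : Measure (EuclideanSpace ℝ (Fin d))) : ℝ≥0∞ :=
  ⨆ (s : ℝ≥0) (_ : fourierEnergy (s : ℝ) θ μ < ∞), (s : ℝ≥0∞)

/-- The Fourier spectrum of a set `X ⊆ ℝ^d` at `θ`: the supremum of `min {dim_F^θ μ, d}` over all
nonzero finite Borel measures `μ` whose (closed) support is contained in `X`. -/
noncomputable def fourierSpectrumSet {d : ℕ} (θ : ℝ)
    (X : Set (EuclideanSpace ℝ (Fin d))) : ℝ≥0∞ :=
  ⨆ (μ : Measure (EuclideanSpace ℝ (Fin d))) (_ : IsFiniteMeasure μ ∧ μ ≠ 0 ∧ μ.support ⊆ X),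
    min (fourierSpectrumMeasure θ μ) (d : ℝ≥0∞)

/-- The Fourier spectrum of a set is finite, so that passing to its real value loses nothing. -/
theorem fourierSpectrumSet_le {d : ℕ} (θ : ℝ) (X : Set (EuclideanSpace ℝ (Fin d))) :
    fourierSpectrumSet θ X ≤ (d : ℝ≥0∞) :=
  iSup₂_le fun _ _ => min_le_right _ _

/-!
Let `W(p, a)` denote the integral of `|μ̂(z)|^p (1 + |z|)^a`. Since `μ̂` is bounded, for `s > 0` and
`θ ∈ (0, 1]` the energy `J_{s,θ}(μ)` is finite exactly when `W(2/θ, s/θ - d)` is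
(`fourierEnergy_lt_top_iff`).

**Dependence on `θ`.** Multiply `μ` by the Gaussian `exp (-π |x|²)`. The support can only shrink,
and `μ̂` is convolved with a Gaussian probability density, so Jensen's inequality and
`(1 + |z|)^a ≤ (1 + |z - w|)^|a| (1 + |w|)^a` show that finiteness of `W(p, a)` is preserved and,
moreover, `|μ̂(z)|^p (1 + |z|)^a` becomes bounded (`gaussianDamping_bounds`). Interpolating between
the integral bound and the uniform bound gives, for `0 ≤ θ < θ' ≤ 1`, that
`dim_F^θ' X ≤ dim_F^θ X + d (θ' - θ)` (`fourierSpectrumSet_le_add`), while Hölder's inequality shows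
that the spectrum is nondecreasing in `θ` (`fourierSpectrumSet_mono`). Hence it is Lipschitz with
constant `d`, and the case `θ = 0` is stronger than the bound to be proved.

**The endpoint `θ = 1`.** Writing `|z|^(t - d)` as a superposition of Gaussians shows that, for
`0 < t < d`, the energy `J_{t,1}(μ)` is a positive multiple of the Riesz energy
`∬ |x - y|^(-t) dμ dμ` (`const_mul_lintegral_enorm_sq_mul_rpow`). If it is finite, comparison of `μ`
with Hausdorff measure gives `t ≤ dim_H X` (`le_dimH_of_energy_lt_top`).

Conversely, a Borel set `X` with `t < dim_H X` carries a measure of finite Riesz energy of order `t`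
(`exists_measure_energy_lt_top`). The Riesz kernel is dominated by `1 + C ∑ φ_q(x) φ_q(y)` for tent
functions `φ_q` on dyadic cubes. Consider the capacity of `A` defined as the infimum of `∑ f_q²`
over `f ≥ 0` with `∑ f_q φ_q ≥ 1` on `A`. It is continuous along increasing sequences of sets
because near-minimisers converge in `ℓ²` (`seqCapacity_iUnion_le`), so Borel sets, being analytic,
are approximated from within by compact sets (`exists_isCompact_le_seqCapacity`). A set of
positive Hausdorff measure in some dimension `s > t` has positive capacity
(`hausdorffMeasure_eq_zero_of_seqCapacity_eq_zero`), and by the Hahn–Banach and Riesz–Markov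
theorems a compact set of positive capacity carries a nonzero finite measure `μ` with
`∑ (∫ φ_q dμ)² < ∞` (`exists_measure_tsum_sq_lt_top`).
-/

/-! ### An `ℓ²` capacity and its increasing sets property -/

/-- The potential `x ↦ ∑ f i * φ i x` of a nonnegative sequence `f` with respect to a family of
nonnegative kernels `φ i`. -/
noncomputable def seqPotential {X ι : Type*} (φ : ι → X → ℝ≥0) (f : ι → ℝ≥0) (x : X) : ℝ≥0∞ :=
  ∑' i, (f i : ℝ≥0∞) * φ i x

/-- The `ℓ²` capacity of `A`: the infimum of `∑ (f i)²` over all `f ≥ 0` whose potential is at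
least `1` on `A`. -/
noncomputable def seqCapacity {X ι : Type*} (φ : ι → X → ℝ≥0) (A : Set X) : ℝ≥0∞ :=
  ⨅ (f : ι → ℝ≥0) (_ : ∀ x ∈ A, 1 ≤ seqPotential φ f x), ∑' i, (f i : ℝ≥0∞) ^ 2

section Capacity

variable {X ι : Type*} {φ : ι → X → ℝ≥0}

lemma seqPotential_mono {f g : ι → ℝ≥0} (h : ∀ i, f i ≤ g i) (x : X) :
    seqPotential φ f x ≤ seqPotential φ g x :=
  ENNReal.tsum_le_tsum fun i => by gcongr; exact h i

lemma seqPotential_add (f g : ι → ℝ≥0) (x : X) :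
    seqPotential φ (fun i => f i + g i) x = seqPotential φ f x + seqPotential φ g x := by
  simp only [seqPotential, ← ENNReal.tsum_add]
  exact tsum_congr fun i => by push_cast; ring

lemma seqPotential_const_mul (c : ℝ≥0) (f : ι → ℝ≥0) (x : X) :
    seqPotential φ (fun i => c * f i) x = c * seqPotential φ f x := by
  simp only [seqPotential, ← ENNReal.tsum_mul_left]
  exact tsum_congr fun i => by push_cast; ring

lemma seqCapacity_le {A : Set X} {f : ι → ℝ≥0} (h : ∀ x ∈ A, 1 ≤ seqPotential φ f x) :
    seqCapacity φ A ≤ ∑' i, (f i : ℝ≥0∞) ^ 2 :=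
  iInf₂_le f h

lemma seqCapacity_mono {A B : Set X} (h : A ⊆ B) : seqCapacity φ A ≤ seqCapacity φ B :=
  le_iInf₂ fun _ hf => seqCapacity_le fun x hx => hf x (h hx)

lemma exists_of_seqCapacity_lt {A : Set X} {c : ℝ≥0∞} (h : seqCapacity φ A < c) :
    ∃ f : ι → ℝ≥0, (∀ x ∈ A, 1 ≤ seqPotential φ f x) ∧ ∑' i, (f i : ℝ≥0∞) ^ 2 < c := by
  simpa only [seqCapacity, iInf_lt_iff, exists_prop] using h

/-- The parallelogram law: near-minimisers for nested sets of nearly equal capacity are close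
in `ℓ²`. The truncated sum `(f i - g i) + (g i - f i)` is `|f i - g i|`. -/
lemma tsum_absDiff_sq_add_le {A B : Set X} (hAB : A ⊆ B) {f g : ι → ℝ≥0}
    (hf : ∀ x ∈ A, 1 ≤ seqPotential φ f x) (hg : ∀ x ∈ B, 1 ≤ seqPotential φ g x) :
    ∑' i, (((f i - g i) + (g i - f i) : ℝ≥0) : ℝ≥0∞) ^ 2 + 4 * seqCapacity φ A ≤
      2 * ∑' i, (f i : ℝ≥0∞) ^ 2 + 2 * ∑' i, (g i : ℝ≥0∞) ^ 2 := by
  have h1 : seqCapacity φ A ≤ ∑' i, (((2⁻¹ : ℝ≥0) * (f i + g i) : ℝ≥0) : ℝ≥0∞) ^ 2 := by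
    refine seqCapacity_le fun x hx => ?_
    rw [seqPotential_const_mul (2⁻¹ : ℝ≥0) (fun i => f i + g i), seqPotential_add]
    calc (1 : ℝ≥0∞) = ((2⁻¹ : ℝ≥0) : ℝ≥0∞) * (1 + 1) := by
          rw [one_add_one_eq_two]; push_cast; norm_num [ENNReal.inv_mul_cancel]
      _ ≤ _ := by gcongr; exacts [hf x hx, hg x (hAB hx)]
  calc _ ≤ ∑' i, (((f i - g i) + (g i - f i) : ℝ≥0) : ℝ≥0∞) ^ 2
        + 4 * ∑' i, (((2⁻¹ : ℝ≥0) * (f i + g i) : ℝ≥0) : ℝ≥0∞) ^ 2 := by gcongr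
    _ = _ := by
      simp only [← ENNReal.tsum_mul_left, ← ENNReal.tsum_add]
      refine tsum_congr fun i => ?_
      have : ((f i - g i) + (g i - f i)) ^ 2 + 4 * ((2⁻¹ : ℝ≥0) * (f i + g i)) ^ 2
          = 2 * f i ^ 2 + 2 * g i ^ 2 := by
        rcases le_total (f i) (g i) with h | h
        · rw [tsub_eq_zero_of_le h]
          apply NNReal.coe_injective
          push_cast [NNReal.coe_sub h]; ring
        · rw [tsub_eq_zero_of_le h]
          apply NNReal.coe_injective
          push_cast [NNReal.coe_sub h]; ring
      exact_mod_cast congrArg ((↑) : ℝ≥0 → ℝ≥0∞) this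

lemma sq_tsub_sq_le (f g l : ℝ≥0) (hl : l ≠ 0) :
    g ^ 2 - f ^ 2 ≤ l⁻¹ * ((f - g) + (g - f)) ^ 2 + l * (f ^ 2 + g ^ 2) := by
  rcases le_total f g with h | h
  · rw [tsub_eq_zero_of_le h, zero_add, tsub_le_iff_right, ← NNReal.coe_le_coe]
    push_cast [NNReal.coe_sub h]
    have hl' : (0 : ℝ) < l := by positivity
    have h2 : ((l : ℝ)⁻¹ * (g - f) - (g + f)) ^ 2 * l =
      (l : ℝ)⁻¹ * (g - f) ^ 2 + l * (g + f) ^ 2 - 2 * (g ^ 2 - f ^ 2) := by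
      field_simp; ring
    have h3 : 0 ≤ ((l : ℝ)⁻¹ * (g - f) - (g + f)) ^ 2 * l := by positivity
    have h4 : 0 ≤ (l : ℝ)⁻¹ * (g - f) ^ 2 := by positivity
    nlinarith [mul_nonneg hl'.le (sq_nonneg ((g : ℝ) - f))]
  · rw [tsub_eq_zero_of_le (by gcongr)]; exact zero_le

/-- The capacity is continuous along increasing sequences of sets. Near-minimisers `g j` for a
subsequence are a fast Cauchy sequence in `ℓ²`, so their pointwise supremum, which is admissible
for the union, costs little more than `g 0`. -/
lemma seqCapacity_iUnion_le {A : ℕ → Set X} (hA : Monotone A) {c : ℝ≥0}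
    (hc : ∀ n, seqCapacity φ (A n) ≤ c) : seqCapacity φ (⋃ n, A n) ≤ c := by
  obtain ⟨c', hc'⟩ : ∃ c' : ℝ≥0, (c' : ℝ≥0∞) = ⨆ n, seqCapacity φ (A n) :=
    ⟨_, ENNReal.coe_toNNReal (ne_top_of_le_ne_top ENNReal.coe_ne_top (iSup_le hc))⟩
  refine le_trans ?_ (hc'.trans_le (iSup_le hc))
  have hle : ∀ n, seqCapacity φ (A n) ≤ c' := fun n =>
    hc' ▸ le_iSup (fun n => seqCapacity φ (A n)) n
  refine ENNReal.le_of_forall_pos_le_add fun ε hε _ => ?_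
  obtain ⟨η, hη, hη1, hηε⟩ : ∃ η : ℝ≥0, 0 < η ∧ η ≤ 1 ∧ η ^ 2 + 2 * η * (12 + 2 * c') ≤ ε := by
    have : (0 : ℝ≥0) < 25 + 4 * c' := by positivity
    refine ⟨min 1 (ε / (25 + 4 * c')), by positivity, min_le_left _ _, ?_⟩
    set η := min 1 (ε / (25 + 4 * c'))
    have h1 : η ≤ 1 := min_le_left _ _
    calc η ^ 2 + 2 * η * (12 + 2 * c') ≤ η * (25 + 4 * c') := by
          have : η ^ 2 ≤ η := by rw [sq]; exact mul_le_of_le_one_left zero_le h1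
          calc _ ≤ η + 2 * η * (12 + 2 * c') := by gcongr
            _ = _ := by ring
      _ ≤ ε / (25 + 4 * c') * (25 + 4 * c') := by gcongr; exact min_le_right _ _
      _ = ε := div_mul_cancel₀ _ this.ne'
  let δ : ℕ → ℝ≥0 := fun j => (η * (1 / 2) ^ j) ^ 2
  have hδ : ∀ j, 0 < δ j := fun j => by positivity
  have hδ1 : ∀ j, δ (j + 1) ≤ δ j := fun j => by
    simp only [δ]
    gcongr (η * ?_) ^ 2
    exact pow_le_pow_of_le_one zero_le (by norm_num) (Nat.le_succ j)
  have hex : ∀ j, ∃ N, ∀ n ≥ N, (c' : ℝ≥0∞) ≤ seqCapacity φ (A n) + δ j := by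
    intro j
    rcases eq_or_ne c' 0 with h0 | h0
    · exact ⟨0, fun n _ => by simp [h0]⟩
    · have : (c' : ℝ≥0∞) - δ j < ⨆ n, seqCapacity φ (A n) := by
        rw [← hc']
        exact ENNReal.sub_lt_self ENNReal.coe_ne_top (by simpa using h0) (by simpa using (hδ j).ne')
      obtain ⟨N, hN⟩ := lt_iSup_iff.1 this
      refine ⟨N, fun n hn => ?_⟩
      rw [← tsub_le_iff_right]
      exact hN.le.trans (seqCapacity_mono (hA hn))
  choose N hN using hex
  -- a monotone sequence of indices `m j ≥ j` along which the capacity is within `δ j` of its limit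
  let m : ℕ → ℕ := fun j => j + ∑ k ∈ Finset.range (j + 1), N k
  have hm : Monotone m := fun i j hij => by
    simp only [m]
    gcongr
  have hmN : ∀ j, N j ≤ m j := fun j => by
    simp only [m]
    exact (Finset.single_le_sum (f := N) (fun _ _ => Nat.zero_le _)
      (Finset.self_mem_range_succ j)).trans (Nat.le_add_left _ _)
  have hg : ∀ j, ∃ g : ι → ℝ≥0, (∀ x ∈ A (m j), 1 ≤ seqPotential φ g x) ∧
      ∑' i, (g i : ℝ≥0∞) ^ 2 < c' + δ j := fun j =>
    exists_of_seqCapacity_lt ((hle _).trans_lt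
      (ENNReal.lt_add_right ENNReal.coe_ne_top (by simpa using (hδ j).ne')))
  choose g hgA hgc using hg
  have hD : ∀ j, ∑' i, (((g j i - g (j + 1) i) + (g (j + 1) i - g j i) : ℝ≥0) : ℝ≥0∞) ^ 2
      ≤ 8 * δ j := by
    intro j
    have h1 := tsum_absDiff_sq_add_le (hA (hm (Nat.le_succ j))) (hgA j) (hgA (j + 1))
    have h2 : (4 * c' : ℝ≥0∞) ≤ 4 * seqCapacity φ (A (m j)) + 4 * δ j := by
      rw [← mul_add]; gcongr; exact hN j _ (hmN j)
    have h3 : (δ (j + 1) : ℝ≥0∞) ≤ δ j := by exact_mod_cast hδ1 j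
    have hfin : (4 * c' : ℝ≥0∞) ≠ ⊤ := ENNReal.mul_ne_top (by simp) ENNReal.coe_ne_top
    refine (ENNReal.add_le_add_iff_right hfin).1 ?_
    calc _ ≤ ∑' i, (((g j i - g (j + 1) i) + (g (j + 1) i - g j i) : ℝ≥0) : ℝ≥0∞) ^ 2
          + (4 * seqCapacity φ (A (m j)) + 4 * δ j) := by gcongr
      _ ≤ (2 * ∑' i, (g j i : ℝ≥0∞) ^ 2 + 2 * ∑' i, (g (j + 1) i : ℝ≥0∞) ^ 2) + 4 * δ j := by
          rw [← add_assoc]; gcongr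
      _ ≤ (2 * (c' + δ j) + 2 * (c' + δ j)) + 4 * δ j := by
          gcongr
          · exact (hgc j).le
          · exact (hgc (j + 1)).le.trans (by gcongr)
      _ = _ := by ring
  have hS : ∀ j, ∑' i, (((g (j + 1) i) ^ 2 - (g j i) ^ 2 : ℝ≥0) : ℝ≥0∞) ≤
      ((η * (12 + 2 * c') * (1 / 2) ^ j : ℝ≥0) : ℝ≥0∞) := by
    intro j
    set l : ℝ≥0 := η * (1 / 2) ^ j
    have hl : l ≠ 0 := by positivity
    have hl1 : l ≤ 1 := mul_le_one' hη1 (pow_le_one₀ zero_le (by norm_num))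
    have hδl : δ j = l ^ 2 := rfl
    calc _ ≤ ∑' i, ((l⁻¹ : ℝ≥0) * (((g j i - g (j + 1) i) + (g (j + 1) i - g j i) : ℝ≥0) : ℝ≥0∞) ^ 2
            + l * ((g j i : ℝ≥0∞) ^ 2 + (g (j + 1) i : ℝ≥0∞) ^ 2)) :=
          ENNReal.tsum_le_tsum fun i => by exact_mod_cast sq_tsub_sq_le (g j i) (g (j + 1) i) l hl
      _ ≤ (l⁻¹ : ℝ≥0) * (8 * δ j) + l * ((c' + δ j) + (c' + δ j)) := by
          rw [ENNReal.tsum_add, ENNReal.tsum_mul_left, ENNReal.tsum_mul_left, ENNReal.tsum_add]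
          gcongr
          · exact hD j
          · exact (hgc j).le
          · exact (hgc (j + 1)).le.trans (by gcongr; exact hδ1 j)
      _ ≤ _ := by
          norm_cast
          rw [hδl]
          have : l⁻¹ * (8 * l ^ 2) = 8 * l := by field_simp
          rw [this]
          calc _ = l * (8 + 2 * c' + 2 * (l * l)) := by ring
            _ ≤ l * (8 + 2 * c' + 2 * (1 * 1)) := by gcongr
            _ ≤ l * (12 + 2 * c') := by
              gcongr l * ?_
              rw [← NNReal.coe_le_coe]; push_cast; linarith
            _ = _ := by simp only [l]; ring
  have hstep : ∀ i j, (g j i : ℝ≥0∞) ^ 2 ≤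
      (g 0 i : ℝ≥0∞) ^ 2 + ∑' k, (((g (k + 1) i) ^ 2 - (g k i) ^ 2 : ℝ≥0) : ℝ≥0∞) := by
    intro i j
    have h1 : (g j i) ^ 2 ≤ (g 0 i) ^ 2 +
        ∑ k ∈ Finset.range j, ((g (k + 1) i) ^ 2 - (g k i) ^ 2) := by
      induction j with
      | zero => simp
      | succ j ih =>
        rw [Finset.sum_range_succ, ← add_assoc]
        calc (g (j + 1) i) ^ 2 ≤ (g j i) ^ 2 + ((g (j + 1) i) ^ 2 - (g j i) ^ 2) :=
              le_add_tsub
          _ ≤ _ := by gcongr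
    calc (g j i : ℝ≥0∞) ^ 2 ≤ (g 0 i : ℝ≥0∞) ^ 2 +
          ∑ k ∈ Finset.range j, (((g (k + 1) i) ^ 2 - (g k i) ^ 2 : ℝ≥0) : ℝ≥0∞) := by
            exact_mod_cast h1
      _ ≤ _ := by gcongr; exact ENNReal.sum_le_tsum _
  -- the pointwise supremum of the `g j`
  let H : ι → ℝ≥0∞ := fun i => ⨆ j, (g j i : ℝ≥0∞)
  have hH2 : ∀ i, H i ^ 2 ≤
      (g 0 i : ℝ≥0∞) ^ 2 + ∑' k, (((g (k + 1) i) ^ 2 - (g k i) ^ 2 : ℝ≥0) : ℝ≥0∞) := by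
    intro i
    have : H i ≤ ((g 0 i : ℝ≥0∞) ^ 2 +
        ∑' k, (((g (k + 1) i) ^ 2 - (g k i) ^ 2 : ℝ≥0) : ℝ≥0∞)) ^ (2 : ℝ)⁻¹ := by
      refine iSup_le fun j => ?_
      rw [ENNReal.le_rpow_inv_iff (by norm_num)]
      exact_mod_cast hstep i j
    rw [ENNReal.le_rpow_inv_iff (by norm_num)] at this
    exact_mod_cast this
  have htot : ∑' i, H i ^ 2 ≤ c' + ε := by
    calc ∑' i, H i ^ 2 ≤ ∑' i, ((g 0 i : ℝ≥0∞) ^ 2 +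
          ∑' k, (((g (k + 1) i) ^ 2 - (g k i) ^ 2 : ℝ≥0) : ℝ≥0∞)) := ENNReal.tsum_le_tsum hH2
      _ = ∑' i, (g 0 i : ℝ≥0∞) ^ 2 +
          ∑' k, ∑' i, (((g (k + 1) i) ^ 2 - (g k i) ^ 2 : ℝ≥0) : ℝ≥0∞) := by
        rw [ENNReal.tsum_add, ENNReal.tsum_comm]
      _ ≤ (c' + δ 0) + ∑' k : ℕ, ((η * (12 + 2 * c') * (1 / 2) ^ k : ℝ≥0) : ℝ≥0∞) := by
        gcongr with k
        · exact (hgc 0).le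
        · exact hS k
      _ = (c' + δ 0) + ((η * (12 + 2 * c') * 2 : ℝ≥0) : ℝ≥0∞) := by
        congr 1
        push_cast
        rw [ENNReal.tsum_mul_left, ENNReal.tsum_geometric]
        simp
      _ ≤ c' + ε := by
        norm_cast
        rw [add_assoc]
        gcongr
        calc _ = η ^ 2 + 2 * η * (12 + 2 * c') := by simp only [δ]; ring
          _ ≤ ε := hηε
  have hHfin : ∀ i, H i ≠ ⊤ := by
    intro i hi
    have : H i ^ 2 ≤ c' + ε := (ENNReal.le_tsum i).trans htot
    rw [hi] at this
    simp at this
  refine (seqCapacity_le (f := fun i => (H i).toNNReal) fun x hx => ?_).trans ?_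
  · obtain ⟨n, hn⟩ := mem_iUnion.1 hx
    have hn' : x ∈ A (m n) := hA (Nat.le_add_right _ _) hn
    refine (hgA n x hn').trans (seqPotential_mono (fun i => ?_) x)
    rw [← ENNReal.coe_le_coe, ENNReal.coe_toNNReal (hHfin i)]
    exact le_iSup (fun j => (g j i : ℝ≥0∞)) n
  · simpa only [ENNReal.coe_toNNReal (hHfin _)] using htot

end Capacity

/-! ### Capacitability of analytic sets -/

section Capacitability

open Filter Topology

variable {X ι : Type*} [TopologicalSpace X] {φ : ι → X → ℝ≥0}

lemma isOpen_lt_seqPotential (hφ : ∀ i, Continuous (φ i)) (f : ι → ℝ≥0) (c : ℝ≥0∞) :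
    IsOpen {x | c < seqPotential φ f x} := by
  have : LowerSemicontinuous (seqPotential φ f) := by
    refine lowerSemicontinuous_tsum fun i => Continuous.lowerSemicontinuous ?_
    have := hφ i
    have h : Continuous fun x => ((f i * φ i x : ℝ≥0) : ℝ≥0∞) := by fun_prop
    simpa using h
  exact this.isOpen_preimage c

lemma exists_isOpen_superset_seqCapacity_lt (hφ : ∀ i, Continuous (φ i)) {A : Set X} {c : ℝ≥0∞}
    (h : seqCapacity φ A < c) : ∃ U, IsOpen U ∧ A ⊆ U ∧ seqCapacity φ U < c := by
  obtain ⟨f, hfA, hfc⟩ := exists_of_seqCapacity_lt h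
  obtain ⟨r, hr1, hr⟩ : ∃ r : ℝ≥0, 1 < r ∧ (r : ℝ≥0∞) ^ 2 * ∑' i, (f i : ℝ≥0∞) ^ 2 < c := by
    have hcont : Tendsto (fun r : ℝ≥0 => (r : ℝ≥0∞) ^ 2 * ∑' i, (f i : ℝ≥0∞) ^ 2) (𝓝 1)
        (𝓝 (((1 : ℝ≥0) : ℝ≥0∞) ^ 2 * ∑' i, (f i : ℝ≥0∞) ^ 2)) := by
      refine ENNReal.Tendsto.mul_const ?_ (Or.inr hfc.ne_top)
      exact ((ENNReal.continuous_pow 2).comp ENNReal.continuous_coe).tendsto 1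
    have h1 : ∀ᶠ r : ℝ≥0 in 𝓝[>] 1, (r : ℝ≥0∞) ^ 2 * ∑' i, (f i : ℝ≥0∞) ^ 2 < c :=
      (hcont.eventually (gt_mem_nhds (by simpa using hfc))).filter_mono nhdsWithin_le_nhds
    obtain ⟨r, hr, hr1⟩ := (h1.and self_mem_nhdsWithin).exists
    exact ⟨r, hr1, hr⟩
  refine ⟨_, isOpen_lt_seqPotential hφ (fun i => r * f i) 1, fun x hx => ?_, ?_⟩
  · show 1 < seqPotential φ (fun i => r * f i) x
    rw [seqPotential_const_mul]
    calc (1 : ℝ≥0∞) < r := by exact_mod_cast hr1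
      _ = r * 1 := (mul_one _).symm
      _ ≤ _ := by gcongr; exact hfA x hx
  · refine (seqCapacity_le (f := fun i => r * f i) fun x hx => hx.le).trans_lt ?_
    simpa only [ENNReal.coe_mul, mul_pow, ENNReal.tsum_mul_left] using hr

/-- If `K` consists of the sequences bounded by `n`, every neighbourhood of its image contains the
image of the sequences for which only finitely many terms are required to be bounded by `n`. -/
lemma exists_image_subset_of_isOpen {f : (ℕ → ℕ) → X} (hf : Continuous f) (n : ℕ → ℕ) {U : Set X}
    (hU : IsOpen U) (hKU : f '' {x | ∀ i, x i ≤ n i} ⊆ U) :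
    ∃ k, f '' {x | ∀ i < k, x i ≤ n i} ⊆ U := by
  by_contra! hcon
  have : ∀ k, ∃ x : ℕ → ℕ, (∀ i < k, x i ≤ n i) ∧ f x ∉ U := by
    intro k
    obtain ⟨_, ⟨x, hx, rfl⟩, hxU⟩ := not_subset.1 (hcon k)
    exact ⟨x, hx, hxU⟩
  choose x hx hxU using this
  have hC : IsCompact {x : ℕ → ℕ | ∀ i, x i ≤ n i} := by
    have := isCompact_univ_pi (fun i => (finite_Iic (n i)).isCompact)
    simpa [Set.pi] using this
  obtain ⟨y, hy, ψ, hψ, hlim⟩ := hC.tendsto_subseq (x := fun k i => min (x k i) (n i))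
    (fun k i => min_le_right _ _)
  have hxlim : Tendsto (fun k => x (ψ k)) atTop (𝓝 y) := by
    rw [tendsto_pi_nhds] at hlim ⊢
    intro i
    refine (hlim i).congr' ?_
    filter_upwards [eventually_gt_atTop i] with k hk
    exact min_eq_left (hx _ i (hk.trans_le (hψ.id_le k)))
  obtain ⟨k, hk⟩ := (((hf.tendsto y).comp hxlim).eventually
    (hU.mem_nhds (hKU ⟨y, hy, rfl⟩))).exists
  exact hxU _ hk

/-- Choquet's capacitability theorem for the `ℓ²` capacity: an analytic set has compact subsets of
almost the same capacity. -/
lemma exists_isCompact_le_seqCapacity (hφ : ∀ i, Continuous (φ i)) {A : Set X}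
    (hA : AnalyticSet A) {c : ℝ≥0} (hc : c < seqCapacity φ A) :
    ∃ K ⊆ A, IsCompact K ∧ c ≤ seqCapacity φ K := by
  rw [AnalyticSet] at hA
  rcases hA with rfl | ⟨f, hf, rfl⟩
  · have : seqCapacity φ (∅ : Set X) ≤ 0 :=
      (seqCapacity_le (f := fun _ => 0) (by simp)).trans (by simp)
    exact absurd (hc.trans_le this) not_lt_zero
  have hstep : ∀ (k : ℕ) (S : {S : Set (ℕ → ℕ) // (c : ℝ≥0∞) < seqCapacity φ (f '' S)}),
      ∃ m : ℕ, (c : ℝ≥0∞) < seqCapacity φ (f '' (S.1 ∩ {x | x k ≤ m})) := by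
    intro k S
    by_contra! hcon
    have hmono : Monotone fun m : ℕ => f '' (S.1 ∩ {x | x k ≤ m}) := fun a b hab =>
      image_mono (inter_subset_inter_right _ fun x (hx : x k ≤ a) => hx.trans hab)
    have h := seqCapacity_iUnion_le hmono hcon
    rw [← image_iUnion, ← inter_iUnion] at h
    have : (⋃ m : ℕ, {x : ℕ → ℕ | x k ≤ m}) = univ :=
      eq_univ_of_forall fun x => mem_iUnion.2 ⟨x k, le_refl (x k)⟩
    rw [this, inter_univ] at h
    exact absurd S.2 (not_lt.2 h)
  choose m hm using hstep
  let S : ℕ → {S : Set (ℕ → ℕ) // (c : ℝ≥0∞) < seqCapacity φ (f '' S)} := fun k =>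
    Nat.rec ⟨univ, by rwa [image_univ]⟩ (fun k T => ⟨T.1 ∩ {x | x k ≤ m k T}, hm k T⟩) k
  have hS : ∀ k, (S k).1 = {x | ∀ i < k, x i ≤ m i (S i)} := by
    intro k
    induction k with
    | zero => simp [S]
    | succ k ih =>
      have : (S (k + 1)).1 = (S k).1 ∩ {x | x k ≤ m k (S k)} := rfl
      rw [this, ih]
      ext x
      simp only [mem_inter_iff, mem_ofPred_eq, Nat.lt_succ_iff_lt_or_eq]
      constructor
      · rintro ⟨h1, h2⟩ i (hi | rfl)
        exacts [h1 i hi, h2]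
      · exact fun h => ⟨fun i hi => h i (Or.inl hi), h k (Or.inr rfl)⟩
  refine ⟨f '' {x | ∀ i, x i ≤ m i (S i)}, image_subset_range _ _, ?_, ?_⟩
  · refine IsCompact.image ?_ hf
    have := isCompact_univ_pi (fun i => (finite_Iic (m i (S i))).isCompact)
    simpa [Set.pi] using this
  · by_contra! hlt
    obtain ⟨U, hU, hKU, hUc⟩ := exists_isOpen_superset_seqCapacity_lt hφ hlt
    obtain ⟨k, hk⟩ := exists_image_subset_of_isOpen hf _ hU hKU
    rw [← hS k] at hk
    exact absurd ((S k).2.trans_le (seqCapacity_mono hk)) hUc.not_gt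

end Capacitability

/-! ### Compact sets of positive capacity carry measures of finite energy -/

section Duality

variable {X ι : Type*}

/-- Duality for the `ℓ²` capacity of a compact set. The potentials of bounded `ℓ²` norm are
separated from the functions `> 1` by a continuous functional on `C(K)`, which is positive and so
is given by a measure. -/
lemma exists_measure_tsum_sq_lt_top [TopologicalSpace X] [T2Space X] [MeasurableSpace X]
    [BorelSpace X] {φ : ι → X → ℝ≥0} (hφ : ∀ i, Continuous (φ i)) {K : Set X} (hK : IsCompact K)
    (hcap : seqCapacity φ K ≠ 0) :
    ∃ μ : Measure X, IsFiniteMeasure μ ∧ μ ≠ 0 ∧ μ Kᶜ = 0 ∧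
      ∑' i, (∫⁻ x, φ i x ∂μ) ^ 2 < ∞ := by
  have : CompactSpace K := isCompact_iff_compactSpace.1 hK
  obtain ⟨R, hR0, hR⟩ := ENNReal.lt_iff_exists_nnreal_btwn.1 (pos_iff_ne_zero.2 hcap)
  have hRpos : (0 : ℝ) < R := by exact_mod_cast hR0
  let ψ : ι → C(K, ℝ) := fun i => ⟨fun x => φ i x, by have := hφ i; fun_prop⟩
  let B : Set (ι →₀ ℝ) := {f | 0 ≤ f ∧ ∑' i, ENNReal.ofReal (f i ^ 2) ≤ R}
  let W : Set C(K, ℝ) := Finsupp.linearCombination ℝ ψ '' B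
  let P : Set C(K, ℝ) := {u | ∀ x ∈ (univ : Set K), u x ∈ Ioi (1 : ℝ)}
  have hB : Convex ℝ B := by
    rintro f ⟨hf0, hf⟩ g ⟨hg0, hg⟩ a b ha hb hab
    refine ⟨add_nonneg (smul_nonneg ha hf0) (smul_nonneg hb hg0), ?_⟩
    calc ∑' i, ENNReal.ofReal ((a • f + b • g) i ^ 2)
        ≤ ∑' i, (ENNReal.ofReal a * ENNReal.ofReal (f i ^ 2) +
            ENNReal.ofReal b * ENNReal.ofReal (g i ^ 2)) := by
          refine ENNReal.tsum_le_tsum fun i => ?_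
          rw [← ENNReal.ofReal_mul ha, ← ENNReal.ofReal_mul hb,
            ← ENNReal.ofReal_add (by positivity) (by positivity)]
          refine ENNReal.ofReal_le_ofReal ?_
          simpa using (convexOn_pow 2).2 (show (0 : ℝ) ≤ f i from hf0 i)
            (show (0 : ℝ) ≤ g i from hg0 i) ha hb hab
      _ ≤ ENNReal.ofReal a * R + ENNReal.ofReal b * R := by
          rw [ENNReal.tsum_add, ENNReal.tsum_mul_left, ENNReal.tsum_mul_left]
          gcongr
      _ = R := by rw [← add_mul, ← ENNReal.ofReal_add ha hb, hab]; simp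
  have hW : Convex ℝ W := hB.linear_image _
  have hPconv : Convex ℝ P := by
    intro u hu v hv a b ha hb hab x hx
    exact convex_Ioi (1 : ℝ) (hu x hx) (hv x hx) ha hb hab
  have hPopen : IsOpen P := ContinuousMap.isOpen_setOfPred_mapsTo isCompact_univ isOpen_Ioi
  have happly : ∀ (f : ι →₀ ℝ) (x : K), Finsupp.linearCombination ℝ ψ f x =
      ∑ i ∈ f.support, f i * φ i x := by
    intro f x
    simp [Finsupp.linearCombination_apply, Finsupp.sum, ψ, ContinuousMap.sum_apply]
  have hdisj : Disjoint P W := by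
    rw [Set.disjoint_left]
    rintro _ hP ⟨f, ⟨hf0, hf⟩, rfl⟩
    refine absurd hR (not_lt.2 ?_)
    refine (seqCapacity_le (f := fun i => (f i).toNNReal) fun x hx => ?_).trans ?_
    · have h1 : (1 : ℝ) ≤ ∑ i ∈ f.support, f i * φ i x :=
        (happly f ⟨x, hx⟩) ▸ (hP ⟨x, hx⟩ (mem_univ _)).le
      calc (1 : ℝ≥0∞) ≤ ENNReal.ofReal (∑ i ∈ f.support, f i * φ i x) := by
            simpa using ENNReal.ofReal_le_ofReal h1
        _ = ∑ i ∈ f.support, ((f i).toNNReal : ℝ≥0∞) * φ i x := by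
            rw [ENNReal.ofReal_sum_of_nonneg (f := fun i => f i * (φ i x : ℝ))
              fun i _ => mul_nonneg (hf0 i) (φ i x).2]
            refine Finset.sum_congr rfl fun i _ => ?_
            rw [ENNReal.ofReal_mul (hf0 i)]; simp [ENNReal.ofReal]
        _ ≤ _ := ENNReal.sum_le_tsum _
    · refine le_of_eq_of_le (tsum_congr fun i => ?_) hf
      rw [ENNReal.ofReal_pow (hf0 i)]; rfl
  obtain ⟨L, u, hLP, hLW⟩ := geometric_hahn_banach_open hPconv hPopen hW hdisj
  have hu0 : u ≤ 0 := by
    have := hLW 0 ⟨0, ⟨le_rfl, by simp⟩, by simp⟩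
    simpa using this
  have hLnonneg : ∀ v : C(K, ℝ), 0 ≤ v → L v ≤ 0 := by
    intro v hv
    by_contra! hpos
    have hmem : ∀ r : ℝ, 0 ≤ r → L ((2 : ℝ) • (1 : C(K, ℝ))) + r * L v < u := by
      intro r hr
      have := hLP ((2 : ℝ) • (1 : C(K, ℝ)) + r • v) fun x _ => by
        have : 0 ≤ r * v x := mul_nonneg hr (hv x)
        show (1 : ℝ) < 2 * 1 + r * v x
        linarith
      rwa [map_add, map_smul L r, smul_eq_mul] at this
    -- otherwise `2 + r v`, for this `r`, violates the separation
    have h := hmem ((u - L ((2 : ℝ) • (1 : C(K, ℝ)))) / L v) (div_nonneg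
      (by have := hmem 0 le_rfl; linarith) hpos.le)
    rw [div_mul_cancel₀ _ hpos.ne'] at h
    linarith
  have hL1 : L 1 ≤ u := by
    have h0 : L 1 ≤ 0 := hLnonneg 1 fun _ => zero_le_one
    have hscale : ∀ ε : ℝ, 0 < ε → (1 + ε) * L 1 < u := by
      intro ε hε
      have h := hLP ((1 + ε) • (1 : C(K, ℝ))) fun x _ => by
        show (1 : ℝ) < (1 + ε) * 1
        linarith
      rwa [map_smul, smul_eq_mul] at h
    by_contra! hlt
    have hneg : L 1 < 0 := h0.lt_of_ne fun h => by
      have := hscale 1 one_pos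
      rw [h] at this
      linarith
    have h := hscale ((L 1 - u) / (-L 1)) (div_pos (by linarith) (by linarith))
    have : (1 + (L 1 - u) / (-L 1)) * L 1 = u := by field_simp [hneg.ne]; ring
    linarith
  have hL1' : L 1 < 0 := by
    have := hLP ((2 : ℝ) • (1 : C(K, ℝ))) fun x _ => by show (1 : ℝ) < 2 * 1; norm_num
    rw [map_smul, smul_eq_mul] at this
    linarith
  let Λ : CompactlySupportedContinuousMap K ℝ →ₚ[ℝ] ℝ :=
  { toFun g := -L g.toContinuousMap
    map_add' g g' := by
      have : (g + g').toContinuousMap = g.toContinuousMap + g'.toContinuousMap := rfl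
      rw [this, map_add]; ring
    map_smul' c g := by
      have : (c • g).toContinuousMap = c • g.toContinuousMap := rfl
      rw [this, map_smul]; simp
    monotone' g g' hgg' := by
      have h := hLnonneg (g'.toContinuousMap - g.toContinuousMap)
        (fun x => sub_nonneg.2 (hgg' x))
      rw [map_sub] at h
      show -L g.toContinuousMap ≤ -L g'.toContinuousMap
      linarith }
  -- the measure on `K` representing `-L`
  let m : Measure K := RealRMK.rieszMeasure Λ
  have hmfin : IsFiniteMeasure m := by
    have : IsFiniteMeasureOnCompacts m := by infer_instance
    infer_instance
  have hint : ∀ g : C(K, ℝ), ∫ x, g x ∂m = -L g := fun g =>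
    RealRMK.integral_rieszMeasure Λ ⟨g, HasCompactSupport.of_compactSpace _⟩
  have hm0 : m ≠ 0 := by
    intro h0
    have := hint 1
    rw [h0, integral_zero_measure] at this
    linarith
  have hemb : MeasurableEmbedding (Subtype.val : K → X) :=
    MeasurableEmbedding.subtype_coe hK.measurableSet
  refine ⟨m.map Subtype.val, inferInstance, ?_, ?_, ?_⟩
  · rwa [Ne, Measure.map_eq_zero_iff hemb.measurable.aemeasurable]
  · rw [hemb.map_apply]
    simp
  have hval : ∀ i, ∫⁻ x, φ i x ∂(m.map Subtype.val) = ENNReal.ofReal (-L (ψ i)) := by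
    intro i
    rw [hemb.lintegral_map, ← hint, ofReal_integral_eq_lintegral_ofReal]
    · simp [ψ, ENNReal.ofReal]
    · exact (ψ i).continuous.integrable_of_hasCompactSupport (HasCompactSupport.of_compactSpace _)
    · exact Filter.Eventually.of_forall fun x => (φ i x).2
  have hLψ : ∀ i, 0 ≤ -L (ψ i) := fun i => by
    have := hLnonneg (ψ i) fun x => (φ i x).2
    linarith
  refine lt_of_le_of_lt (b := ENNReal.ofReal ((L 1) ^ 2 / R)) ?_ ENNReal.ofReal_lt_top
  rw [ENNReal.tsum_eq_iSup_sum]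
  refine iSup_le fun F => ?_
  simp only [hval]
  rw [Finset.sum_congr rfl fun i _ => (ENNReal.ofReal_pow (hLψ i) 2).symm,
    ← ENNReal.ofReal_sum_of_nonneg fun i _ => sq_nonneg _]
  refine ENNReal.ofReal_le_ofReal ?_
  set M := ∑ i ∈ F, (-L (ψ i)) ^ 2 with hM
  have hM0 : 0 ≤ M := Finset.sum_nonneg fun i _ => sq_nonneg _
  rcases hM0.eq_or_lt with h0 | hMpos
  · rw [← h0]; positivity
  -- test against the multiple of `i ↦ ∫ φ i` on `F` whose squared `ℓ²` norm is exactly `R`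
  set l := Real.sqrt (R / M)
  have hl : l ^ 2 = R / M := Real.sq_sqrt (by positivity)
  have hl0 : 0 ≤ l := Real.sqrt_nonneg _
  classical
  let f : ι →₀ ℝ := Finsupp.onFinset F (fun i => if i ∈ F then l * (-L (ψ i)) else 0)
    (fun i hi => by by_contra h; simp [h] at hi)
  have hfB : f ∈ B := by
    constructor
    · intro i
      show (0 : ℝ) ≤ if i ∈ F then l * (-L (ψ i)) else 0
      split_ifs
      exacts [mul_nonneg hl0 (hLψ i), le_rfl]
    · have hsum : ∑' i, ENNReal.ofReal (f i ^ 2) = ∑ i ∈ F, ENNReal.ofReal (f i ^ 2) :=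
        tsum_eq_sum fun i hi => by simp [f, hi]
      rw [hsum, ← ENNReal.ofReal_sum_of_nonneg fun i _ => sq_nonneg _]
      have : ∑ i ∈ F, f i ^ 2 = R := by
        have h1 : ∑ i ∈ F, f i ^ 2 = ∑ i ∈ F, l ^ 2 * (-L (ψ i)) ^ 2 :=
          Finset.sum_congr rfl fun i hi => by simp [f, hi, mul_pow]
        rw [h1, ← Finset.mul_sum, hl, ← hM]
        field_simp
      rw [this]; simp
  have hLf : L (Finsupp.linearCombination ℝ ψ f) = -(l * M) := by
    rw [Finsupp.linearCombination_apply, Finsupp.sum_of_support_subset f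
      Finsupp.support_onFinset_subset _ (by simp), map_sum, hM, Finset.mul_sum,
      ← Finset.sum_neg_distrib]
    refine Finset.sum_congr rfl fun i hi => ?_
    rw [map_smul]
    simp [f, hi]; ring
  have h1 : l * M ≤ -L 1 := by
    have := hLW _ ⟨f, hfB, rfl⟩
    linarith
  rw [le_div_iff₀ hRpos]
  calc M * R = (l * M) ^ 2 := by rw [mul_pow, hl]; field_simp
    _ ≤ (-L 1) ^ 2 := by gcongr
    _ = _ := by ring

end Duality

/-! ### Dyadic kernels: capacity, Hausdorff measure and Riesz energy -/

section DyadicKernel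

open Filter Topology

variable {d : ℕ}

/-- The sup-norm distance of `2^j x` to the lattice point `n`, where `q = (j, n)`. -/
noncomputable def dyadicDist (q : ℕ × (Fin d → ℤ)) (x : EuclideanSpace ℝ (Fin d)) : ℝ :=
  ‖(fun i => 2 ^ q.1 * x i - q.2 i : Fin d → ℝ)‖

/-- The continuous tent function of height `2^(jt/2) * 3` on the open cube with centre `2^(-j) n`
and side `6 * 2^(-j)`, where `q = (j, n)`. For `t > 0` and
`|x - y| ≤ 1`, the kernel `∑ φ_q(x) φ_q(y)` is
comparable with `|x - y|^(-t)`. -/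
noncomputable def dyadicKernel (t : ℝ) (q : ℕ × (Fin d → ℤ)) (x : EuclideanSpace ℝ (Fin d)) :
    ℝ≥0 :=
  ((2 : ℝ≥0) ^ (t / 2)) ^ q.1 * Real.toNNReal (3 - dyadicDist q x)

lemma continuous_dyadicDist (q : ℕ × (Fin d → ℤ)) : Continuous (dyadicDist q) := by
  unfold dyadicDist
  fun_prop

lemma continuous_dyadicKernel (t : ℝ) (q : ℕ × (Fin d → ℤ)) : Continuous (dyadicKernel t q) := by
  have := continuous_dyadicDist q
  unfold dyadicKernel
  exact continuous_const.mul (continuous_real_toNNReal.comp (continuous_const.sub this))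

/-- At each scale, at most `7^d` of the tents are nonzero at a given point. -/
lemma tsum_toNNReal_sub_dyadicDist_le (j : ℕ) (x : EuclideanSpace ℝ (Fin d)) :
    ∑' n : Fin d → ℤ, (Real.toNNReal (3 - dyadicDist (j, n) x) : ℝ≥0∞) ≤ 3 * 7 ^ d := by
  let F : Finset (Fin d → ℤ) :=
    Fintype.piFinset fun i => Finset.Icc (⌈2 ^ j * x i⌉ - 3) (⌈2 ^ j * x i⌉ + 3)
  have hF : ∀ n ∉ F, (Real.toNNReal (3 - dyadicDist (j, n) x) : ℝ≥0∞) = 0 := by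
    intro n hn
    by_contra h
    refine hn (Fintype.mem_piFinset.2 fun i => ?_)
    have hlt : dyadicDist (j, n) x < 3 := by
      by_contra! h3
      exact h (by rw [Real.toNNReal_of_nonpos (by linarith)]; rfl)
    have hi : |2 ^ j * x i - n i| < 3 :=
      (norm_le_pi_norm (fun i => 2 ^ j * x i - n i : Fin d → ℝ) i).trans_lt hlt
    rw [abs_lt] at hi
    have h1 := Int.le_ceil (2 ^ j * x i)
    have h2 := Int.ceil_lt_add_one (2 ^ j * x i)
    rw [Finset.mem_Icc]
    constructor
    · have : ((⌈2 ^ j * x i⌉ : ℤ) : ℝ) < ((n i + 4 : ℤ) : ℝ) := by push_cast; linarith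
      have := Int.cast_lt.1 this
      omega
    · have : (n i : ℝ) < ((⌈2 ^ j * x i⌉ + 3 : ℤ) : ℝ) := by push_cast; linarith
      exact (Int.cast_lt.1 this).le
  rw [tsum_eq_sum hF]
  calc ∑ n ∈ F, (Real.toNNReal (3 - dyadicDist (j, n) x) : ℝ≥0∞) ≤ ∑ n ∈ F, 3 := by
        refine Finset.sum_le_sum fun n _ => ?_
        have : Real.toNNReal (3 - dyadicDist (j, n) x) ≤ 3 := by
          rw [Real.toNNReal_le_iff_le_coe]
          have : 0 ≤ dyadicDist (j, n) x := norm_nonneg _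
          push_cast
          linarith
        exact_mod_cast this
    _ = 3 * 7 ^ d := by
        rw [Finset.sum_const, nsmul_eq_mul, mul_comm]
        congr 1
        have : F.card = 7 ^ d := by
          rw [Fintype.card_piFinset]
          simp only [Int.card_Icc]
          rw [Finset.prod_congr rfl (g := fun _ => 7) fun i _ => by omega]
          simp
        rw [this]; push_cast; rfl

lemma ediam_dyadicDist_lt_le (q : ℕ × (Fin d → ℤ)) :
    Metric.ediam {x : EuclideanSpace ℝ (Fin d) | dyadicDist q x < 3} ≤
      ENNReal.ofReal (6 * (d + 1)) * ENNReal.ofReal ((1 / 2) ^ q.1) := by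
  refine Metric.ediam_le fun x hx y hy => ?_
  rw [edist_dist, ← ENNReal.ofReal_mul (by positivity)]
  refine ENNReal.ofReal_le_ofReal ?_
  have hcoord : ∀ i, (x i - y i) ^ 2 ≤ (6 * (1 / 2) ^ q.1) ^ 2 := by
    intro i
    have h1 : |2 ^ q.1 * x i - q.2 i| < 3 :=
      (norm_le_pi_norm (fun i => 2 ^ q.1 * x i - q.2 i : Fin d → ℝ) i).trans_lt hx
    have h2 : |2 ^ q.1 * y i - q.2 i| < 3 :=
      (norm_le_pi_norm (fun i => 2 ^ q.1 * y i - q.2 i : Fin d → ℝ) i).trans_lt hy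
    rw [abs_lt] at h1 h2
    have h3 : |2 ^ q.1 * (x i - y i)| ≤ 6 := by
      rw [abs_le]; constructor <;> linarith
    rw [abs_mul, abs_of_pos (by positivity)] at h3
    rw [← sq_abs (x i - y i)]
    gcongr
    rw [one_div, inv_pow, ← div_eq_mul_inv, le_div_iff₀ (by positivity)]
    linarith
  have h : dist x y ^ 2 ≤ (6 * (d + 1) * (1 / 2) ^ q.1) ^ 2 := by
    rw [EuclideanSpace.dist_eq, Real.sq_sqrt (by positivity)]
    calc ∑ i, dist (x i) (y i) ^ 2 ≤ ∑ i : Fin d, (6 * (1 / 2) ^ q.1 : ℝ) ^ 2 :=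
          Finset.sum_le_sum fun i _ => by
            rw [Real.dist_eq, sq_abs]; exact hcoord i
      _ = d * (6 * (1 / 2) ^ q.1 : ℝ) ^ 2 := by simp
      _ ≤ (d + 1) ^ 2 * (6 * (1 / 2) ^ q.1 : ℝ) ^ 2 := by
          gcongr
          nlinarith [(Nat.cast_nonneg d : (0 : ℝ) ≤ d)]
      _ = _ := by ring
  exact (le_abs_self _).trans (abs_le_of_sq_le_sq h (by positivity))

/-- If the potential of `f` is at least `1` at `x`, then `f` is large on one of the cubes that
contain `x`. -/
lemma exists_large_coeff {t s : ℝ} (hts : t < s) : ∃ c : ℝ≥0, 0 < c ∧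
    ∀ (f : ℕ × (Fin d → ℤ) → ℝ≥0) (x : EuclideanSpace ℝ (Fin d)),
      1 ≤ seqPotential (dyadicKernel t) f x → ∃ q, dyadicDist q x < 3 ∧
        c * ((2 : ℝ≥0) ^ (-((s - t) / 2))) ^ q.1 ≤ f q * ((2 : ℝ≥0) ^ (t / 2)) ^ q.1 := by
  set ρ : ℝ≥0 := (2 : ℝ≥0) ^ (-((s - t) / 2))
  have hρ : ρ < 1 := NNReal.rpow_lt_one_of_one_lt_of_neg (by norm_num) (by linarith)
  obtain ⟨c, hc0, hc⟩ : ∃ c : ℝ≥0, 0 < c ∧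
      (c : ℝ≥0∞) * ((∑' j : ℕ, (ρ : ℝ≥0∞) ^ j) * (3 * 7 ^ d)) < 1 := by
    rw [ENNReal.tsum_geometric]
    have h1 : (1 - (ρ : ℝ≥0∞))⁻¹ * (3 * 7 ^ d) ≠ ⊤ := by
      refine ENNReal.mul_ne_top (ENNReal.inv_ne_top.2 ?_) ?_
      · exact (tsub_pos_of_lt (by exact_mod_cast hρ)).ne'
      · exact ENNReal.mul_ne_top (by simp) (ENNReal.pow_ne_top (by simp))
    obtain ⟨c, hc0, hc⟩ := ENNReal.exists_nnreal_pos_mul_lt h1 one_ne_zero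
    exact ⟨c, hc0, hc⟩
  refine ⟨c, hc0, fun f x hx => ?_⟩
  by_contra! hcon
  refine absurd hx (not_le.2 (lt_of_le_of_lt ?_ hc))
  calc seqPotential (dyadicKernel t) f x
      = ∑' j : ℕ, ∑' n : Fin d → ℤ, (f (j, n) : ℝ≥0∞) * dyadicKernel t (j, n) x := ENNReal.tsum_prod'
    _ ≤ ∑' j : ℕ, ∑' n : Fin d → ℤ,
        ((c * ρ ^ j : ℝ≥0) : ℝ≥0∞) * (Real.toNNReal (3 - dyadicDist (j, n) x)) := by
        refine ENNReal.tsum_le_tsum fun j => ENNReal.tsum_le_tsum fun n => ?_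
        rcases lt_or_ge (dyadicDist (j, n) x) 3 with h | h
        · have := (hcon (j, n) h).le
          norm_cast
          rw [dyadicKernel, ← mul_assoc]
          gcongr
        · simp [dyadicKernel, Real.toNNReal_of_nonpos (show 3 - dyadicDist (j, n) x ≤ 0 by linarith)]
    _ ≤ ∑' j : ℕ, ((c * ρ ^ j : ℝ≥0) : ℝ≥0∞) * (3 * 7 ^ d) := by
        refine ENNReal.tsum_le_tsum fun j => ?_
        rw [ENNReal.tsum_mul_left]
        gcongr
        exact tsum_toNNReal_sub_dyadicDist_le j x
    _ = _ := by
        push_cast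
        rw [ENNReal.tsum_mul_right, ENNReal.tsum_mul_left, mul_assoc]

/-- Sets of zero capacity for the exponent `t` are null for Hausdorff measure in every dimension
`s > t`: the cubes on which an admissible `f` is large cover the set, and the sum of the `s`-th
powers of their diameters is controlled by the `ℓ²` norm of `f`. -/
lemma hausdorffMeasure_eq_zero_of_seqCapacity_eq_zero {t s : ℝ} (hs : 0 < s) (hts : t < s)
    {A : Set (EuclideanSpace ℝ (Fin d))} (hA : seqCapacity (dyadicKernel t) A = 0) :
    μH[s] A = 0 := by
  obtain ⟨c, hc0, hc⟩ := exists_large_coeff (d := d) hts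
  let C : ℝ≥0∞ := ENNReal.ofReal (6 * (d + 1)) ^ s * ((c : ℝ≥0∞)⁻¹) ^ 2
  have hC : C ≠ ⊤ := ENNReal.mul_ne_top (ENNReal.rpow_ne_top_of_nonneg hs.le ENNReal.ofReal_ne_top)
    (ENNReal.pow_ne_top (by simpa using hc0.ne'))
  have hex : ∀ k : ℕ, ∃ f : ℕ × (Fin d → ℤ) → ℝ≥0,
      (∀ x ∈ A, 1 ≤ seqPotential (dyadicKernel t) f x) ∧
        ∑' i, (f i : ℝ≥0∞) ^ 2 < ((k : ℝ≥0∞) + 1)⁻¹ := fun k =>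
    exists_of_seqCapacity_lt (by
      rw [hA]
      exact ENNReal.inv_pos.2 (ENNReal.add_ne_top.2 ⟨ENNReal.natCast_ne_top k, by simp⟩))
  choose f hfA hf using hex
  let U : ∀ k : ℕ, ℕ × (Fin d → ℤ) → Set (EuclideanSpace ℝ (Fin d)) := fun k q =>
    {x | dyadicDist q x < 3 ∧
      c * ((2 : ℝ≥0) ^ (-((s - t) / 2))) ^ q.1 ≤ f k q * ((2 : ℝ≥0) ^ (t / 2)) ^ q.1}
  have hdiam : ∀ k q, Metric.ediam (U k q) ^ s ≤ C * (f k q : ℝ≥0∞) ^ 2 := by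
    intro k q
    by_cases hq : c * ((2 : ℝ≥0) ^ (-((s - t) / 2))) ^ q.1 ≤ f k q * ((2 : ℝ≥0) ^ (t / 2)) ^ q.1
    · have h1 : Metric.ediam (U k q) ≤
          ENNReal.ofReal (6 * (d + 1)) * ENNReal.ofReal ((1 / 2) ^ q.1) :=
        (Metric.ediam_mono fun x hx => hx.1).trans (ediam_dyadicDist_lt_le q)
      have h2 : ENNReal.ofReal ((1 / 2) ^ q.1) ^ s ≤ ((c : ℝ≥0∞)⁻¹) ^ 2 * (f k q : ℝ≥0∞) ^ 2 := by
        have h3 : c * ((2 : ℝ≥0) ^ (-(s / 2))) ^ q.1 ≤ f k q := by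
          have h4 : ((2 : ℝ≥0) ^ (-((s - t) / 2))) ^ q.1 =
              ((2 : ℝ≥0) ^ (-(s / 2))) ^ q.1 * ((2 : ℝ≥0) ^ (t / 2)) ^ q.1 := by
            rw [← mul_pow, ← NNReal.rpow_add two_ne_zero]
            ring_nf
          rw [h4, ← mul_assoc] at hq
          exact le_of_mul_le_mul_right hq (by positivity)
        have h6 : ((1 / 2 : ℝ≥0) ^ q.1) ^ s = (((2 : ℝ≥0) ^ (-(s / 2))) ^ q.1) ^ 2 := by
          rw [one_div, ← NNReal.rpow_natCast, ← NNReal.rpow_natCast, ← NNReal.rpow_natCast,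
            ← NNReal.rpow_mul, ← NNReal.rpow_mul, ← NNReal.rpow_mul, ← NNReal.rpow_neg_one,
            ← NNReal.rpow_mul]
          congr 1
          push_cast; ring
        have h7 : ENNReal.ofReal ((1 / 2) ^ q.1) = (((1 / 2 : ℝ≥0) ^ q.1 : ℝ≥0) : ℝ≥0∞) := by
          rw [ENNReal.ofReal, ENNReal.coe_inj]
          apply NNReal.coe_injective
          rw [Real.coe_toNNReal _ (by positivity)]
          push_cast; rfl
        rw [h7, ← ENNReal.coe_rpow_of_nonneg _ hs.le, h6, ← ENNReal.coe_inv hc0.ne']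
        norm_cast
        rw [← mul_pow]
        gcongr
        rw [inv_mul_eq_div, le_div_iff₀ hc0]
        linarith
      calc Metric.ediam (U k q) ^ s ≤
            (ENNReal.ofReal (6 * (d + 1)) * ENNReal.ofReal ((1 / 2) ^ q.1)) ^ s := by gcongr
        _ = ENNReal.ofReal (6 * (d + 1)) ^ s * ENNReal.ofReal ((1 / 2) ^ q.1) ^ s :=
            ENNReal.mul_rpow_of_nonneg _ _ hs.le
        _ ≤ ENNReal.ofReal (6 * (d + 1)) ^ s * (((c : ℝ≥0∞)⁻¹) ^ 2 * (f k q : ℝ≥0∞) ^ 2) := by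
            gcongr
        _ = _ := (mul_assoc _ _ _).symm
    · have : U k q = ∅ := eq_empty_of_forall_notMem fun x hx => hq hx.2
      rw [this, Metric.ediam_empty, ENNReal.zero_rpow_of_pos hs]
      exact zero_le
  have hsum : ∀ k, ∑' q, Metric.ediam (U k q) ^ s ≤ C * ((k : ℝ≥0∞) + 1)⁻¹ := fun k =>
    calc _ ≤ ∑' q, C * (f k q : ℝ≥0∞) ^ 2 := ENNReal.tsum_le_tsum (hdiam k)
      _ ≤ _ := by rw [ENNReal.tsum_mul_left]; gcongr; exact (hf k).le
  have hlim : Tendsto (fun k : ℕ => C * ((k : ℝ≥0∞) + 1)⁻¹) atTop (𝓝 0) := by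
    have h1 : Tendsto (fun k : ℕ => ((k : ℝ≥0∞) + 1)⁻¹) atTop (𝓝 0) := by
      have := (tendsto_add_atTop_iff_nat 1).2 ENNReal.tendsto_inv_nat_nhds_zero
      simpa using this
    simpa using ENNReal.Tendsto.const_mul h1 (Or.inr hC)
  have hr : Tendsto (fun k : ℕ => (C * ((k : ℝ≥0∞) + 1)⁻¹) ^ s⁻¹) atTop (𝓝 0) := by
    have := ((ENNReal.continuous_rpow_const (y := s⁻¹)).tendsto 0).comp hlim
    rwa [ENNReal.zero_rpow_of_pos (inv_pos.2 hs)] at this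
  have hmain := Measure.hausdorffMeasure_le_liminf_tsum s A _ hr U
    (Eventually.of_forall fun k q => by
      rw [ENNReal.le_rpow_inv_iff hs]
      exact (ENNReal.le_tsum q).trans (hsum k))
    (Eventually.of_forall fun k x hx => by
      obtain ⟨q, hq1, hq2⟩ := hc (f k) x (hfA k x hx)
      exact mem_iUnion.2 ⟨q, hq1, hq2⟩)
  refine le_antisymm (hmain.trans ?_) zero_le
  calc _ ≤ liminf (fun k : ℕ => C * ((k : ℝ≥0∞) + 1)⁻¹) atTop :=
        liminf_le_liminf (Eventually.of_forall hsum)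
    _ = 0 := hlim.liminf_eq

lemma pow_le_tsum_dyadicKernel_mul (t : ℝ) (j : ℕ) {x y : EuclideanSpace ℝ (Fin d)}
    (h : 2 ^ j * ‖x - y‖ ≤ 1) :
    (((2 : ℝ≥0) ^ t) ^ j : ℝ≥0) ≤
      ∑' q, (dyadicKernel t q x : ℝ≥0∞) * dyadicKernel t q y := by
  -- a single cube at scale `j` already contributes enough
  let n : Fin d → ℤ := fun i => ⌊2 ^ j * x i⌋
  have hx : dyadicDist (j, n) x ≤ 1 := by
    refine (pi_norm_le_iff_of_nonneg zero_le_one).2 fun i => ?_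
    have h1 := Int.floor_le (2 ^ j * x i)
    have h2 := Int.lt_floor_add_one (2 ^ j * x i)
    rw [Real.norm_eq_abs, abs_le]
    simp only [n]
    constructor <;> linarith
  have hy : dyadicDist (j, n) y ≤ 2 := by
    refine (pi_norm_le_iff_of_nonneg zero_le_two).2 fun i => ?_
    have h1 := Int.floor_le (2 ^ j * x i)
    have h2 := Int.lt_floor_add_one (2 ^ j * x i)
    have h3 : |x i - y i| ≤ ‖x - y‖ := by
      simpa using PiLp.norm_apply_le (x - y) i
    have h4 : |2 ^ j * (x i - y i)| ≤ 1 := by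
      rw [abs_mul, abs_of_pos (by positivity)]
      exact le_trans (by gcongr) h
    rw [abs_le] at h4
    rw [Real.norm_eq_abs, abs_le]
    simp only [n]
    constructor <;> linarith
  refine le_trans ?_ (ENNReal.le_tsum (j, n))
  norm_cast
  have h1 : (1 : ℝ≥0) ≤ Real.toNNReal (3 - dyadicDist (j, n) x) := by
    rw [Real.le_toNNReal_iff_coe_le (by linarith)]; push_cast; linarith
  have h2 : (1 : ℝ≥0) ≤ Real.toNNReal (3 - dyadicDist (j, n) y) := by
    rw [Real.le_toNNReal_iff_coe_le (by linarith)]; push_cast; linarith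
  have h3 : (2 : ℝ≥0) ^ t = (2 : ℝ≥0) ^ (t / 2) * (2 : ℝ≥0) ^ (t / 2) := by
    rw [← NNReal.rpow_add two_ne_zero]; ring_nf
  calc ((2 : ℝ≥0) ^ t) ^ j = (((2 : ℝ≥0) ^ (t / 2)) ^ j * 1) * (((2 : ℝ≥0) ^ (t / 2)) ^ j * 1) := by
        rw [h3, mul_pow]; ring
    _ ≤ _ := by unfold dyadicKernel; gcongr

lemma enorm_rpow_neg_le_tsum_dyadicKernel {t : ℝ} (ht : 0 < t) (x y : EuclideanSpace ℝ (Fin d)) :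
    ‖x - y‖ₑ ^ (-t) ≤ 1 + ((2 : ℝ≥0) ^ t : ℝ≥0) *
      ∑' q, (dyadicKernel t q x : ℝ≥0∞) * dyadicKernel t q y := by
  rcases eq_or_ne x y with rfl | hne
  · have h2 : (1 : ℝ≥0) < 2 ^ t := NNReal.one_lt_rpow (by norm_num) ht
    have htop : ∑' q, (dyadicKernel t q x : ℝ≥0∞) * dyadicKernel t q x = ⊤ := by
      refine ENNReal.eq_top_of_forall_nnreal_le fun r => ?_
      obtain ⟨j, hj⟩ := pow_unbounded_of_one_lt r h2
      exact (ENNReal.coe_le_coe.2 hj.le).trans (pow_le_tsum_dyadicKernel_mul t j (by simp))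
    rw [htop, ENNReal.mul_top (by positivity)]
    simp
  have hpos : 0 < ‖x - y‖ := norm_pos_iff.2 (sub_ne_zero.2 hne)
  rcases le_or_gt 1 ‖x - y‖ with h1 | h1
  · refine le_trans ?_ le_self_add
    rw [ENNReal.rpow_neg, ENNReal.inv_le_one]
    refine ENNReal.one_le_rpow ?_ ht
    rw [← ofReal_norm]
    exact ENNReal.one_le_ofReal.2 h1
  · refine le_trans ?_ le_add_self
    obtain ⟨j, hj1, hj2⟩ := exists_nat_pow_near_of_lt_one hpos h1.le
      (show (0 : ℝ) < 1 / 2 by norm_num) (by norm_num)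
    have hj : 2 ^ j * ‖x - y‖ ≤ 1 := by
      rw [one_div, inv_pow] at hj2
      rw [mul_comm, ← le_div_iff₀ (by positivity), one_div]
      exact hj2
    refine le_trans ?_ (mul_le_mul_right (pow_le_tsum_dyadicKernel_mul t j hj) _)
    rw [← ENNReal.coe_mul, ← pow_succ']
    rw [ENNReal.rpow_neg, ENNReal.inv_le_iff_inv_le]
    rw [← ENNReal.coe_inv (by positivity), ← enorm_norm, Real.enorm_of_nonneg hpos.le,
      ENNReal.ofReal, ← ENNReal.coe_rpow_of_nonneg _ ht.le]
    rw [ENNReal.coe_le_coe, ← inv_pow, ← NNReal.inv_rpow, ← NNReal.rpow_natCast, ← NNReal.rpow_mul,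
      mul_comm t, NNReal.rpow_mul, NNReal.rpow_natCast]
    gcongr
    rw [Real.le_toNNReal_iff_coe_le hpos.le]
    push_cast
    simpa using hj1.le

/-- The Riesz energy of order `t` is controlled by the squares of the integrals of the dyadic
kernels. -/
lemma lintegral_enorm_rpow_neg_lt_top {t : ℝ} (ht : 0 < t)
    {μ : Measure (EuclideanSpace ℝ (Fin d))} [IsFiniteMeasure μ]
    (h : ∑' q, (∫⁻ x, dyadicKernel t q x ∂μ) ^ 2 < ∞) :
    ∫⁻ x, ∫⁻ y, ‖x - y‖ₑ ^ (-t) ∂μ ∂μ < ∞ := by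
  have hmeas : ∀ q : ℕ × (Fin d → ℤ), Measurable fun x => (dyadicKernel t q x : ℝ≥0∞) := fun q =>
    (continuous_dyadicKernel t q).measurable.coe_nnreal_ennreal
  calc ∫⁻ x, ∫⁻ y, ‖x - y‖ₑ ^ (-t) ∂μ ∂μ
      ≤ ∫⁻ x, ∫⁻ y, (1 + ((2 : ℝ≥0) ^ t : ℝ≥0) *
          ∑' q, (dyadicKernel t q x : ℝ≥0∞) * dyadicKernel t q y) ∂μ ∂μ :=
        lintegral_mono fun x => lintegral_mono fun y => enorm_rpow_neg_le_tsum_dyadicKernel ht x y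
    _ = ∫⁻ x, (μ univ + ((2 : ℝ≥0) ^ t : ℝ≥0) *
          ∑' q, (dyadicKernel t q x : ℝ≥0∞) * ∫⁻ y, dyadicKernel t q y ∂μ) ∂μ := by
        refine lintegral_congr fun x => ?_
        rw [lintegral_add_left measurable_const, lintegral_const_mul' _ _ ENNReal.coe_ne_top,
          lintegral_tsum fun q => ((hmeas q).const_mul _).aemeasurable]
        simp only [lintegral_const_mul _ (hmeas _)]
        simp
    _ = μ univ * μ univ + ((2 : ℝ≥0) ^ t : ℝ≥0) *
          ∑' q, (∫⁻ x, dyadicKernel t q x ∂μ) ^ 2 := by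
        rw [lintegral_add_left measurable_const, lintegral_const_mul' _ _ ENNReal.coe_ne_top,
          lintegral_tsum fun q => ((hmeas q).mul_const _).aemeasurable]
        simp only [lintegral_mul_const _ (hmeas _), lintegral_const, sq]
    _ < ∞ := ENNReal.add_lt_top.2 ⟨ENNReal.mul_lt_top (measure_lt_top _ _) (measure_lt_top _ _),
        ENNReal.mul_lt_top ENNReal.coe_lt_top h⟩

/-- A Frostman-type lemma: a Borel set of Hausdorff dimension larger than `t` supports a nonzero
finite measure of finite Riesz energy of order `t`. -/
lemma exists_measure_energy_lt_top {t : ℝ≥0} (ht : 0 < t) {X : Set (EuclideanSpace ℝ (Fin d))}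
    (hX : MeasurableSet X) (h : t < dimH X) :
    ∃ μ : Measure (EuclideanSpace ℝ (Fin d)), IsFiniteMeasure μ ∧ μ ≠ 0 ∧ μ.support ⊆ X ∧
      ∫⁻ x, ∫⁻ y, ‖x - y‖ₑ ^ (-(t : ℝ)) ∂μ ∂μ < ∞ := by
  obtain ⟨s, hts, hs⟩ := ENNReal.lt_iff_exists_nnreal_btwn.1 h
  have hts' : t < s := by exact_mod_cast hts
  have hcap : seqCapacity (dyadicKernel t) X ≠ 0 := fun h0 => by
    have h1 := hausdorffMeasure_eq_zero_of_seqCapacity_eq_zero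
      (s := s) (by exact_mod_cast ht.trans hts') (by exact_mod_cast hts') h0
    rw [hausdorffMeasure_of_lt_dimH hs] at h1
    exact ENNReal.top_ne_zero h1
  obtain ⟨c, hc0, hc⟩ := ENNReal.lt_iff_exists_nnreal_btwn.1 (pos_iff_ne_zero.2 hcap)
  obtain ⟨K, hKX, hK, hKc⟩ := exists_isCompact_le_seqCapacity (continuous_dyadicKernel (d := d) t)
    hX.analyticSet hc
  obtain ⟨μ, hμ, hμ0, hμK, hsum⟩ := exists_measure_tsum_sq_lt_top
    (continuous_dyadicKernel (d := d) t) hK (hc0.trans_le hKc).ne'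
  exact ⟨μ, hμ, hμ0, (Measure.support_subset_of_isClosed hK.isClosed hμK).trans hKX,
    lintegral_enorm_rpow_neg_lt_top (by exact_mod_cast ht) hsum⟩

end DyadicKernel

/-! ### Riesz energy and the Fourier transform -/

section FourierEnergy

open Filter Topology

variable {d : ℕ}

lemma norm_exp_two_pi_mul_I (r : ℝ) : ‖Complex.exp (-2 * Real.pi * Complex.I * r)‖ = 1 := by
  have : (-2 * Real.pi * Complex.I * r : ℂ) = ((-2 * Real.pi * r : ℝ) : ℂ) * Complex.I := by
    push_cast; ring
  rw [this, Complex.norm_exp_ofReal_mul_I]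

lemma continuous_fourierTransformMeasure (μ : Measure (EuclideanSpace ℝ (Fin d)))
    [IsFiniteMeasure μ] : Continuous (fourierTransformMeasure μ) := by
  refine continuous_of_dominated (bound := fun _ => 1) (fun z => ?_) (fun z => ?_) ?_ ?_
  · exact Continuous.aestronglyMeasurable (by fun_prop)
  · exact Eventually.of_forall fun x => (norm_exp_two_pi_mul_I _).le
  · exact integrable_const _
  · exact Eventually.of_forall fun x => by fun_prop

lemma enorm_fourierTransformMeasure_le (μ : Measure (EuclideanSpace ℝ (Fin d)))
    (z : EuclideanSpace ℝ (Fin d)) : ‖fourierTransformMeasure μ z‖ₑ ≤ μ univ := by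
  refine (enorm_integral_le_lintegral_enorm _).trans ?_
  have : ∀ x, ‖Complex.exp (-2 * Real.pi * Complex.I * (inner ℝ z x : ℝ))‖ₑ = 1 := fun x => by
    rw [← ofReal_norm, norm_exp_two_pi_mul_I, ENNReal.ofReal_one]
  simp only [this, lintegral_one, le_refl]

lemma norm_sq_fourierTransformMeasure (μ : Measure (EuclideanSpace ℝ (Fin d))) [IsFiniteMeasure μ]
    (z : EuclideanSpace ℝ (Fin d)) : ((‖fourierTransformMeasure μ z‖ ^ 2 : ℝ) : ℂ) =
      ∫ p : EuclideanSpace ℝ (Fin d) × EuclideanSpace ℝ (Fin d),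
        Complex.exp (2 * Real.pi * Complex.I * (inner ℝ (p.2 - p.1) z : ℝ)) ∂(μ.prod μ) := by
  have h1 : (starRingEnd ℂ) (fourierTransformMeasure μ z) =
      ∫ x, Complex.exp (2 * Real.pi * Complex.I * (inner ℝ z x : ℝ)) ∂μ := by
    rw [fourierTransformMeasure, ← integral_conj]
    refine integral_congr_ae (Eventually.of_forall fun x => ?_)
    simp [← Complex.exp_conj, Complex.conj_ofReal, map_ofNat (starRingEnd ℂ) 2]
  rw [← Complex.normSq_eq_norm_sq, Complex.normSq_eq_conj_mul_self, h1, mul_comm,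
    fourierTransformMeasure, ← integral_prod_mul]
  refine integral_congr_ae (Eventually.of_forall fun p => ?_)
  simp only [← Complex.exp_add]
  congr 1
  rw [inner_sub_left, real_inner_comm z p.1, real_inner_comm z p.2]
  push_cast; ring

lemma integrable_exp_neg_mul_norm_sq {b : ℝ} (hb : 0 < b) :
    Integrable fun z : EuclideanSpace ℝ (Fin d) => Real.exp (-b * ‖z‖ ^ 2) := by
  have h := GaussianFourier.integrable_cexp_neg_mul_sq_norm_add (b := (b : ℂ))
    (by simpa using hb) 0 (0 : EuclideanSpace ℝ (Fin d))
  refine h.norm.congr (Eventually.of_forall fun z => ?_)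
  simp only [Complex.norm_exp]
  congr 1
  simp [← Complex.ofReal_pow]

/-- The Fourier transform of a Gaussian, applied under the integral sign. -/
lemma lintegral_enorm_sq_mul_gaussian (μ : Measure (EuclideanSpace ℝ (Fin d))) [IsFiniteMeasure μ]
    {u : ℝ} (hu : 0 < u) :
    ∫⁻ z, ‖fourierTransformMeasure μ z‖ₑ ^ (2 : ℝ) *
        ENNReal.ofReal (Real.exp (-(Real.pi * ‖z‖ ^ 2 * u))) =
      ∫⁻ x, ∫⁻ y, ENNReal.ofReal (u ^ (-(d : ℝ) / 2) *
        Real.exp (-(Real.pi * ‖x - y‖ ^ 2 / u))) ∂μ ∂μ := by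
  have hb : 0 < Real.pi * u := by positivity
  have hg := integrable_exp_neg_mul_norm_sq (d := d) hb
  have hcont := continuous_fourierTransformMeasure μ
  have hint1 : Integrable fun z => ‖fourierTransformMeasure μ z‖ ^ 2 *
      Real.exp (-(Real.pi * u) * ‖z‖ ^ 2) := by
    refine hg.bdd_mul (c := (μ univ).toReal ^ 2) (by fun_prop) (Eventually.of_forall fun z => ?_)
    rw [Real.norm_of_nonneg (by positivity)]
    gcongr
    have := ENNReal.toReal_mono (measure_ne_top μ univ) (enorm_fourierTransformMeasure_le μ z)
    simpa using this
  have hint2 : Integrable (fun p : EuclideanSpace ℝ (Fin d) × EuclideanSpace ℝ (Fin d) =>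
      u ^ (-(d : ℝ) / 2) * Real.exp (-(Real.pi * ‖p.1 - p.2‖ ^ 2 / u))) (μ.prod μ) := by
    refine Integrable.of_bound (C := u ^ (-(d : ℝ) / 2))
      (Continuous.aestronglyMeasurable (by fun_prop)) (Eventually.of_forall fun p => ?_)
    rw [Real.norm_of_nonneg (by positivity)]
    refine mul_le_of_le_one_right (by positivity) (Real.exp_le_one_iff.2 ?_)
    rw [neg_nonpos]
    positivity
  have hmain : ∫ z, ‖fourierTransformMeasure μ z‖ ^ 2 * Real.exp (-(Real.pi * u) * ‖z‖ ^ 2) =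
      ∫ p : EuclideanSpace ℝ (Fin d) × EuclideanSpace ℝ (Fin d),
        u ^ (-(d : ℝ) / 2) * Real.exp (-(Real.pi * ‖p.1 - p.2‖ ^ 2 / u)) ∂(μ.prod μ) := by
    rw [← Complex.ofReal_inj, ← integral_complex_ofReal, ← integral_complex_ofReal]
    calc _ = ∫ z, ∫ p : EuclideanSpace ℝ (Fin d) × EuclideanSpace ℝ (Fin d),
          Complex.exp (-((Real.pi * u : ℝ) : ℂ) * ‖z‖ ^ 2 +
            2 * Real.pi * Complex.I * (inner ℝ (p.2 - p.1) z : ℝ)) ∂(μ.prod μ) := by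
          refine integral_congr_ae (Eventually.of_forall fun z => ?_)
          simp only
          rw [Complex.ofReal_mul, norm_sq_fourierTransformMeasure, mul_comm,
            ← integral_const_mul]
          refine integral_congr_ae (Eventually.of_forall fun p => ?_)
          simp only [Complex.ofReal_exp, ← Complex.exp_add]
          congr 1
          push_cast; ring
      _ = ∫ p : EuclideanSpace ℝ (Fin d) × EuclideanSpace ℝ (Fin d), (∫ z,
          Complex.exp (-((Real.pi * u : ℝ) : ℂ) * ‖z‖ ^ 2 +
            2 * Real.pi * Complex.I * (inner ℝ (p.2 - p.1) z : ℝ))) ∂(μ.prod μ) := by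
          refine integral_integral_swap ?_
          have h := hg.mul_prod (integrable_const (μ := μ.prod μ) (1 : ℝ))
          refine h.mono' (Continuous.aestronglyMeasurable (by unfold Function.uncurry; fun_prop))
            (Eventually.of_forall fun q => ?_)
          simp only [Function.uncurry, Complex.norm_exp, mul_one]
          refine Real.exp_le_exp.2 (le_of_eq ?_)
          simp [← Complex.ofReal_pow]
      _ = _ := by
          refine integral_congr_ae (Eventually.of_forall fun p => ?_)
          simp only
          rw [GaussianFourier.integral_cexp_neg_mul_sq_norm_add
            (by rw [Complex.ofReal_re]; exact hb)]
          have hpi : (Real.pi : ℂ) ≠ 0 := by exact_mod_cast Real.pi_ne_zero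
          have hu' : (u : ℂ) ≠ 0 := by exact_mod_cast hu.ne'
          rw [Complex.ofReal_mul (u ^ (-(d : ℝ) / 2)), Complex.ofReal_exp, Complex.ofReal_cpow hu.le]
          congr 1
          · have h2 : (Real.pi : ℂ) / ((Real.pi * u : ℝ) : ℂ) = ((u⁻¹ : ℝ) : ℂ) := by
              push_cast; field_simp
            rw [h2]
            have h3 : ((Module.finrank ℝ (EuclideanSpace ℝ (Fin d)) : ℂ) / 2) =
              (((d : ℝ) / 2 : ℝ) : ℂ) := by simp
            rw [h3, ← Complex.ofReal_cpow (by positivity), ← Complex.ofReal_cpow hu.le,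
              Complex.ofReal_inj, Real.inv_rpow hu.le, ← Real.rpow_neg hu.le]
            congr 1; ring
          · congr 1
            rw [norm_sub_rev p.2 p.1]
            push_cast
            field_simp
            rw [Complex.I_sq]; ring
  have e1 : ∫⁻ z, ‖fourierTransformMeasure μ z‖ₑ ^ (2 : ℝ) *
        ENNReal.ofReal (Real.exp (-(Real.pi * ‖z‖ ^ 2 * u))) =
      ENNReal.ofReal (∫ z, ‖fourierTransformMeasure μ z‖ ^ 2 *
        Real.exp (-(Real.pi * u) * ‖z‖ ^ 2)) := by
    rw [ofReal_integral_eq_lintegral_ofReal hint1 (Eventually.of_forall fun z => by positivity)]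
    refine lintegral_congr fun z => ?_
    rw [ENNReal.ofReal_mul (by positivity), ENNReal.ofReal_pow (norm_nonneg _), ofReal_norm]
    congr 1
    · norm_cast
    · congr 2; ring
  rw [e1, hmain, ofReal_integral_eq_lintegral_ofReal hint2
    (Eventually.of_forall fun z => by positivity), lintegral_prod]
  exact Measurable.aemeasurable (by fun_prop)

lemma lintegral_rpow_mul_exp_neg_mul {a r : ℝ} (ha : 0 < a) (hr : 0 < r) :
    ∫⁻ u in Ioi (0 : ℝ), ENNReal.ofReal (u ^ (a - 1) * Real.exp (-(r * u))) =
      ENNReal.ofReal ((1 / r) ^ a * Real.Gamma a) := by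
  have key := Real.integral_rpow_mul_exp_neg_mul_Ioi ha hr
  have hG := Real.Gamma_pos_of_pos ha
  have hint : IntegrableOn (fun u => u ^ (a - 1) * Real.exp (-(r * u))) (Ioi 0) :=
    .of_integral_ne_zero (by rw [key]; positivity)
  rw [← key, ofReal_integral_eq_lintegral_ofReal hint]
  refine (ae_restrict_iff' measurableSet_Ioi).2 (Eventually.of_forall fun u hu => ?_)
  have : (0 : ℝ) < u := hu
  show (0 : ℝ) ≤ _
  positivity

lemma lintegral_rpow_mul_exp_neg_div {a r : ℝ} (ha : 0 < a) (hr : 0 < r) :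
    ∫⁻ u in Ioi (0 : ℝ), ENNReal.ofReal (u ^ (-a - 1) * Real.exp (-(r / u))) =
      ENNReal.ofReal ((1 / r) ^ a * Real.Gamma a) := by
  rw [← lintegral_rpow_mul_exp_neg_mul ha hr]
  have himg : (fun u : ℝ => u⁻¹) '' Ioi 0 = Ioi 0 := by
    ext v
    constructor
    · rintro ⟨u, hu, rfl⟩
      exact inv_pos.2 (mem_Ioi.1 hu)
    · exact fun hv => ⟨v⁻¹, mem_Ioi.2 (inv_pos.2 (mem_Ioi.1 hv)), inv_inv v⟩
  conv_rhs => rw [← himg]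
  rw [lintegral_image_eq_lintegral_abs_deriv_mul measurableSet_Ioi
    (fun u hu => (hasDerivAt_inv (ne_of_gt hu)).hasDerivWithinAt) inv_injective.injOn]
  refine setLIntegral_congr_fun measurableSet_Ioi fun u hu => ?_
  have hu : (0 : ℝ) < u := hu
  rw [← ENNReal.ofReal_mul (abs_nonneg _), abs_neg, abs_of_pos (by positivity), ← mul_assoc,
    div_eq_mul_inv r u]
  congr 2
  rw [Real.inv_rpow hu.le, ← Real.rpow_neg hu.le, ← Real.rpow_natCast u 2, ← Real.rpow_neg hu.le,
    ← Real.rpow_add hu]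
  congr 1
  push_cast; ring

lemma one_div_pi_mul_sq_rpow {ρ a : ℝ} (hρ : 0 < ρ) :
    (1 / (Real.pi * ρ ^ 2)) ^ a = Real.pi ^ (-a) * ρ ^ (-(2 * a)) := by
  rw [one_div, Real.inv_rpow (by positivity), ← Real.rpow_neg (by positivity),
    Real.mul_rpow Real.pi_pos.le (by positivity), ← Real.rpow_natCast ρ 2, ← Real.rpow_mul hρ.le]
  congr 2
  push_cast; ring

/-- The integral representation of `ρ ^ (-t)`, valid also for `ρ = 0`, where both sides are
infinite. -/
lemma lintegral_rpow_mul_exp_neg_pi_div {t : ℝ} (ht : 0 < t) (x : EuclideanSpace ℝ (Fin d)) :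
    ∫⁻ u in Ioi (0 : ℝ), ENNReal.ofReal (u ^ (-(t / 2) - 1) *
        Real.exp (-(Real.pi * ‖x‖ ^ 2 / u))) =
      ENNReal.ofReal (Real.pi ^ (-(t / 2)) * Real.Gamma (t / 2)) * ‖x‖ₑ ^ (-t) := by
  have hpos : ∀ ρ : ℝ, 0 < ρ → ∫⁻ u in Ioi (0 : ℝ), ENNReal.ofReal (u ^ (-(t / 2) - 1) *
        Real.exp (-(Real.pi * ρ ^ 2 / u))) =
      ENNReal.ofReal (Real.pi ^ (-(t / 2)) * Real.Gamma (t / 2)) *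
        ENNReal.ofReal ρ ^ (-t) := by
    intro ρ hρ
    have hG := Real.Gamma_pos_of_pos (half_pos ht)
    rw [lintegral_rpow_mul_exp_neg_div (half_pos ht) (by positivity), one_div_pi_mul_sq_rpow hρ,
      ENNReal.ofReal_rpow_of_pos hρ, ← ENNReal.ofReal_mul (by positivity)]
    congr 1
    rw [mul_div_cancel₀ t two_ne_zero]; ring
  rcases eq_or_ne x 0 with rfl | hx
  · have hG := Real.Gamma_pos_of_pos (half_pos ht)
    have hc : ENNReal.ofReal (Real.pi ^ (-(t / 2)) * Real.Gamma (t / 2)) ≠ 0 := by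
      rw [Ne, ENNReal.ofReal_eq_zero, not_le]; positivity
    rw [enorm_zero, ENNReal.zero_rpow_of_neg (by linarith), ENNReal.mul_top hc]
    -- the integral dominates `c * ρ ^ (-t)` for every `ρ > 0`
    have hle : ∀ n : ℕ, ENNReal.ofReal (Real.pi ^ (-(t / 2)) * Real.Gamma (t / 2)) *
        ((n : ℝ≥0∞) + 1) ^ t ≤ ∫⁻ u in Ioi (0 : ℝ), ENNReal.ofReal (u ^ (-(t / 2) - 1) *
          Real.exp (-(Real.pi * ‖(0 : EuclideanSpace ℝ (Fin d))‖ ^ 2 / u))) := by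
      intro n
      have h1 := hpos (1 / ((n : ℝ) + 1)) (by positivity)
      have h2 : ENNReal.ofReal (1 / ((n : ℝ) + 1)) ^ (-t) = ((n : ℝ≥0∞) + 1) ^ t := by
        rw [one_div, ENNReal.ofReal_inv_of_pos (by positivity), ENNReal.rpow_neg, ENNReal.inv_rpow,
          inv_inv, ENNReal.ofReal_add (by positivity) zero_le_one]
        simp
      rw [h2] at h1
      rw [← h1]
      refine setLIntegral_mono' measurableSet_Ioi fun u hu => ENNReal.ofReal_le_ofReal ?_
      have hu : (0 : ℝ) < u := hu
      gcongr
      simp only [norm_zero]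
      positivity
    have h1 : Tendsto (fun n : ℕ => ((n : ℝ≥0∞) + 1) ^ t) atTop (𝓝 ⊤) := by
      have h2 : Tendsto (fun n : ℕ => ((n : ℝ≥0∞) + 1)) atTop (𝓝 ⊤) := by
        have := (tendsto_add_atTop_iff_nat 1).2 ENNReal.tendsto_nat_nhds_top
        simpa using this
      have := ((ENNReal.continuous_rpow_const (y := t)).tendsto ⊤).comp h2
      rwa [ENNReal.top_rpow_of_pos ht] at this
    have := ENNReal.Tendsto.const_mul h1 (Or.inl ENNReal.top_ne_zero)
      (a := ENNReal.ofReal (Real.pi ^ (-(t / 2)) * Real.Gamma (t / 2)))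
    rw [ENNReal.mul_top hc] at this
    exact top_le_iff.1 (le_of_tendsto' this hle)
  · rw [hpos _ (norm_pos_iff.2 hx), ofReal_norm]

lemma lintegral_rpow_mul_exp_neg_pi_mul {b : ℝ} (hb : 0 < b) {x : EuclideanSpace ℝ (Fin d)}
    (hx : x ≠ 0) :
    ∫⁻ u in Ioi (0 : ℝ), ENNReal.ofReal (u ^ (b / 2 - 1) *
        Real.exp (-(Real.pi * ‖x‖ ^ 2 * u))) =
      ENNReal.ofReal (Real.pi ^ (-(b / 2)) * Real.Gamma (b / 2)) * ‖x‖ₑ ^ (-b) := by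
  have hG := Real.Gamma_pos_of_pos (half_pos hb)
  have hρ := norm_pos_iff.2 hx
  rw [lintegral_rpow_mul_exp_neg_mul (half_pos hb) (by positivity), one_div_pi_mul_sq_rpow hρ,
    ← ofReal_norm, ENNReal.ofReal_rpow_of_pos hρ, ← ENNReal.ofReal_mul (by positivity)]
  congr 1
  rw [mul_div_cancel₀ b two_ne_zero]; ring

/-- The Riesz energy of a measure in terms of its Fourier transform: superpose the Gaussian
identities with weight `u ^ ((d - t) / 2 - 1)`. -/
lemma const_mul_lintegral_enorm_sq_mul_rpow {t : ℝ} (ht : 0 < t) (htd : t < d)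
    (μ : Measure (EuclideanSpace ℝ (Fin d))) [IsFiniteMeasure μ] :
    ENNReal.ofReal (Real.pi ^ (-((d - t) / 2)) * Real.Gamma ((d - t) / 2)) *
        ∫⁻ z, ‖fourierTransformMeasure μ z‖ₑ ^ (2 : ℝ) * ‖z‖ₑ ^ (t - d) =
      ENNReal.ofReal (Real.pi ^ (-(t / 2)) * Real.Gamma (t / 2)) *
        ∫⁻ x, ∫⁻ y, ‖x - y‖ₑ ^ (-t) ∂μ ∂μ := by
  have hd : 0 < d := by
    have : (0 : ℝ) < d := ht.trans htd
    exact_mod_cast this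
  have : Nonempty (Fin d) := ⟨⟨0, hd⟩⟩
  have hcont := continuous_fourierTransformMeasure μ
  have hne : ∀ᵐ z : EuclideanSpace ℝ (Fin d), z ≠ 0 := by
    simp [ae_iff]
  have hexp : ∀ u : ℝ, 0 < u → u ^ ((d - t) / 2 - 1) * u ^ (-(d : ℝ) / 2) =
      u ^ (-(t / 2) - 1) := fun u hu => by
    rw [← Real.rpow_add hu]; congr 1; ring
  calc _ = ∫⁻ z, ‖fourierTransformMeasure μ z‖ₑ ^ (2 : ℝ) *
        ∫⁻ u in Ioi (0 : ℝ), ENNReal.ofReal (u ^ ((d - t) / 2 - 1) *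
          Real.exp (-(Real.pi * ‖z‖ ^ 2 * u))) := by
        rw [← lintegral_const_mul' _ _ ENNReal.ofReal_ne_top]
        refine lintegral_congr_ae (hne.mono fun z hz => ?_)
        simp only
        rw [lintegral_rpow_mul_exp_neg_pi_mul (by linarith) hz, neg_sub]
        ring
    _ = ∫⁻ z, ∫⁻ u in Ioi (0 : ℝ), ‖fourierTransformMeasure μ z‖ₑ ^ (2 : ℝ) *
          ENNReal.ofReal (u ^ ((d - t) / 2 - 1) * Real.exp (-(Real.pi * ‖z‖ ^ 2 * u))) := by
        refine lintegral_congr fun z => ?_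
        rw [lintegral_const_mul]
        fun_prop
    _ = ∫⁻ u in Ioi (0 : ℝ), ∫⁻ z, ‖fourierTransformMeasure μ z‖ₑ ^ (2 : ℝ) *
          ENNReal.ofReal (u ^ ((d - t) / 2 - 1) * Real.exp (-(Real.pi * ‖z‖ ^ 2 * u))) := by
        refine lintegral_lintegral_swap (Measurable.aemeasurable ?_)
        have := hcont.measurable
        unfold Function.uncurry
        fun_prop
    _ = ∫⁻ u in Ioi (0 : ℝ), ∫⁻ x, ∫⁻ y, ENNReal.ofReal (u ^ (-(t / 2) - 1) *
          Real.exp (-(Real.pi * ‖x - y‖ ^ 2 / u))) ∂μ ∂μ := by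
        refine setLIntegral_congr_fun measurableSet_Ioi fun u hu => ?_
        have hu : (0 : ℝ) < u := hu
        have h := lintegral_enorm_sq_mul_gaussian μ hu
        have h0 : (0 : ℝ) ≤ u ^ ((d - t) / 2 - 1) := by positivity
        calc _ = ENNReal.ofReal (u ^ ((d - t) / 2 - 1)) *
              ∫⁻ z, ‖fourierTransformMeasure μ z‖ₑ ^ (2 : ℝ) *
                ENNReal.ofReal (Real.exp (-(Real.pi * ‖z‖ ^ 2 * u))) := by
              rw [← lintegral_const_mul' _ _ ENNReal.ofReal_ne_top]
              refine lintegral_congr fun z => ?_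
              rw [ENNReal.ofReal_mul h0]; ring
          _ = _ := by
              rw [h, ← lintegral_const_mul' _ _ ENNReal.ofReal_ne_top]
              refine lintegral_congr fun x => ?_
              rw [← lintegral_const_mul' _ _ ENNReal.ofReal_ne_top]
              refine lintegral_congr fun y => ?_
              rw [← ENNReal.ofReal_mul h0, ← mul_assoc, hexp u hu]
    _ = ∫⁻ x, ∫⁻ y, (∫⁻ u in Ioi (0 : ℝ), ENNReal.ofReal (u ^ (-(t / 2) - 1) *
          Real.exp (-(Real.pi * ‖x - y‖ ^ 2 / u)))) ∂μ ∂μ := by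
        rw [lintegral_lintegral_swap]
        · refine lintegral_congr fun x => lintegral_lintegral_swap (Measurable.aemeasurable ?_)
          unfold Function.uncurry
          fun_prop
        · refine Measurable.aemeasurable ?_
          unfold Function.uncurry
          refine Measurable.lintegral_prod_right' (f := fun q : (ℝ × EuclideanSpace ℝ (Fin d)) ×
            EuclideanSpace ℝ (Fin d) => ENNReal.ofReal (q.1.1 ^ (-(t / 2) - 1) *
              Real.exp (-(Real.pi * ‖q.1.2 - q.2‖ ^ 2 / q.1.1)))) ?_
          fun_prop
    _ = _ := by
        simp only [lintegral_rpow_mul_exp_neg_pi_div ht]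
        rw [← lintegral_const_mul' _ _ ENNReal.ofReal_ne_top]
        refine lintegral_congr fun x => ?_
        rw [lintegral_const_mul' _ _ ENNReal.ofReal_ne_top]

lemma fourierEnergy_one (s : ℝ) (μ : Measure (EuclideanSpace ℝ (Fin d))) :
    fourierEnergy s 1 μ =
      ∫⁻ z, ‖fourierTransformMeasure μ z‖ₑ ^ (2 : ℝ) * ‖z‖ₑ ^ (s - d) := by
  simp [fourierEnergy]

lemma fourierEnergy_one_lt_top_iff {t : ℝ} (ht : 0 < t) (htd : t < d)
    (μ : Measure (EuclideanSpace ℝ (Fin d))) [IsFiniteMeasure μ] :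
    fourierEnergy t 1 μ < ∞ ↔ ∫⁻ x, ∫⁻ y, ‖x - y‖ₑ ^ (-t) ∂μ ∂μ < ∞ := by
  have h := const_mul_lintegral_enorm_sq_mul_rpow ht htd μ
  rw [← fourierEnergy_one] at h
  have h1 := Real.Gamma_pos_of_pos (half_pos ht)
  have h2 := Real.Gamma_pos_of_pos (half_pos (sub_pos.2 htd))
  have hc : ∀ {r : ℝ}, 0 < r → ∀ x : ℝ≥0∞, ENNReal.ofReal r * x < ∞ ↔ x < ∞ := fun hr x => by
    rw [ENNReal.mul_lt_top_iff]
    constructor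
    · rintro (h | h | h)
      · exact h.2
      · exact absurd (ENNReal.ofReal_eq_zero.1 h) (not_le.2 hr)
      · simp [h]
    · exact fun h => Or.inl ⟨ENNReal.ofReal_lt_top, h⟩
  rw [← hc (r := Real.pi ^ (-((d - t) / 2)) * Real.Gamma ((d - t) / 2)) (by positivity), h,
    hc (by positivity)]

/-- The energy method: a set that carries a measure of finite Riesz energy of order `t` has
Hausdorff dimension at least `t`. -/
lemma le_dimH_of_energy_lt_top {t : ℝ≥0} (ht : 0 < t) {X : Set (EuclideanSpace ℝ (Fin d))}
    {μ : Measure (EuclideanSpace ℝ (Fin d))} [IsFiniteMeasure μ] (hμ : μ ≠ 0)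
    (hX : μ.support ⊆ X) (h : ∫⁻ x, ∫⁻ y, ‖x - y‖ₑ ^ (-(t : ℝ)) ∂μ ∂μ < ∞) :
    (t : ℝ≥0∞) ≤ dimH X := by
  have ht' : (0 : ℝ) < t := by exact_mod_cast ht
  have hmeas : Measurable fun x => ∫⁻ y, ‖x - y‖ₑ ^ (-(t : ℝ)) ∂μ := by
    refine Measurable.lintegral_prod_right' (f := fun q : EuclideanSpace ℝ (Fin d) ×
      EuclideanSpace ℝ (Fin d) => ‖q.1 - q.2‖ₑ ^ (-(t : ℝ))) ?_
    fun_prop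
  -- the potential of `μ` is bounded by some `M` on a set of positive measure
  obtain ⟨M, hM⟩ : ∃ M : ℕ, μ {x | ∫⁻ y, ‖x - y‖ₑ ^ (-(t : ℝ)) ∂μ ≤ M} ≠ 0 := by
    by_contra! hcon
    have hfin := ae_lt_top hmeas h.ne
    refine hμ (Measure.measure_univ_eq_zero.1 ?_)
    have h1 : μ (⋃ M : ℕ, {x | ∫⁻ y, ‖x - y‖ₑ ^ (-(t : ℝ)) ∂μ ≤ M}) = 0 :=
      measure_iUnion_null hcon
    have h2 : ∀ᵐ x ∂μ, x ∉ ⋃ M : ℕ, {x | ∫⁻ y, ‖x - y‖ₑ ^ (-(t : ℝ)) ∂μ ≤ M} :=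
      measure_eq_zero_iff_ae_notMem.1 h1
    have h3 : ∀ᵐ x ∂μ, False := by
      filter_upwards [hfin, h2] with x hx hx2
      obtain ⟨n, hn⟩ := ENNReal.exists_nat_gt hx.ne
      exact hx2 (mem_iUnion.2 ⟨n, hn.le⟩)
    simpa [ae_iff] using h3
  set A := {x | ∫⁻ y, ‖x - y‖ₑ ^ (-(t : ℝ)) ∂μ ≤ M} ∩ μ.support
  have hA : μ A ≠ 0 := by
    rwa [measure_inter_conull' (measure_mono_null (fun x hx => hx.2)
      (Measure.measure_compl_support (μ := μ)))]
  have hball : ∀ U : Set (EuclideanSpace ℝ (Fin d)),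
      μ (U ∩ A) ≤ M * Metric.ediam U ^ (t : ℝ) := by
    intro U
    rcases (U ∩ A).eq_empty_or_nonempty with h0 | ⟨x, hxU, hxA⟩
    · rw [h0, measure_empty]; exact zero_le
    have h1 : Metric.ediam U ^ (-(t : ℝ)) * μ (U ∩ A) ≤ M := by
      calc Metric.ediam U ^ (-(t : ℝ)) * μ (U ∩ A)
          ≤ Metric.ediam U ^ (-(t : ℝ)) * μ (closure U) := by
            gcongr; exact inter_subset_left.trans subset_closure
        _ = ∫⁻ y in closure U, Metric.ediam U ^ (-(t : ℝ)) ∂μ := (setLIntegral_const _ _).symm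
        _ ≤ ∫⁻ y in closure U, ‖x - y‖ₑ ^ (-(t : ℝ)) ∂μ := by
            refine setLIntegral_mono' isClosed_closure.measurableSet fun y hy => ?_
            rw [ENNReal.rpow_neg, ENNReal.rpow_neg]
            gcongr
            rw [← edist_eq_enorm_sub, ← Metric.ediam_closure]
            exact Metric.edist_le_ediam_of_mem (subset_closure hxU) hy
        _ ≤ ∫⁻ y, ‖x - y‖ₑ ^ (-(t : ℝ)) ∂μ := setLIntegral_le_lintegral _ _
        _ ≤ M := hxA.1
    rcases eq_or_ne (Metric.ediam U) 0 with hz | hz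
    · rw [hz, ENNReal.zero_rpow_of_neg (by linarith)] at h1
      by_contra hlt
      have : μ (U ∩ A) ≠ 0 := fun h => hlt (by rw [h]; exact zero_le)
      rw [ENNReal.top_mul this, top_le_iff] at h1
      exact ENNReal.natCast_ne_top M h1
    · rcases eq_or_ne (Metric.ediam U) ⊤ with hT | hT
      · rw [hT, ENNReal.top_rpow_of_pos ht']
        rcases Nat.eq_zero_or_pos M with hM0 | hM0
        · exfalso
          have : ∫⁻ y, ‖x - y‖ₑ ^ (-(t : ℝ)) ∂μ = 0 := by
            have := hxA.1
            simpa [hM0] using this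
          rw [lintegral_eq_zero_iff (by fun_prop)] at this
          refine hμ (ae_eq_bot.1 (eventually_false_iff_eq_bot.1 (this.mono fun y hy => ?_)))
          simp [ENNReal.rpow_eq_zero_iff, ht'.not_gt] at hy
        · rw [ENNReal.mul_top (by exact_mod_cast hM0.ne')]; exact le_top
      · rw [ENNReal.rpow_neg, mul_comm, ← div_eq_mul_inv] at h1
        exact (ENNReal.div_le_iff_le_mul
          (Or.inl (by simp [hz, ht'.not_gt, ENNReal.rpow_eq_zero_iff]))
          (Or.inl (ENNReal.rpow_ne_top_of_nonneg ht'.le hT))).1 h1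
  refine (le_dimH_of_hausdorffMeasure_ne_zero (s := A) fun h0 => hA ?_).trans
    (dimH_mono (inter_subset_right.trans hX))
  have hAm : MeasurableSet A := (measurableSet_le hmeas measurable_const).inter
    Measure.isClosed_support.measurableSet
  have hle : ((M : ℝ≥0∞) + 1)⁻¹ • μ.restrict A ≤ μH[t] := by
    refine Measure.le_hausdorffMeasure _ _ 1 one_pos fun U _ => ?_
    rw [Measure.smul_apply, Measure.restrict_apply' hAm, smul_eq_mul, mul_comm, ← div_eq_mul_inv]
    refine ENNReal.div_le_of_le_mul ((hball U).trans ?_)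
    rw [mul_comm]
    gcongr
    exact le_self_add
  have h1 := hle A
  rw [h0, Measure.smul_apply, Measure.restrict_apply_self, smul_eq_mul, nonpos_iff_eq_zero,
    mul_eq_zero] at h1
  refine h1.resolve_left (ENNReal.inv_ne_zero.2 ?_)
  simp

end FourierEnergy

/-! ### Weighted Fourier integrals and Gaussian damping -/

section Damping

open Filter Topology

variable {d : ℕ}

/-- The integral `∫ |μ̂(z)|^p (1 + |z|)^a dz`. The inhomogeneous weight removes the singularity of
the weight `|z|^a` of `fourierEnergy` at the origin. -/
noncomputable def weightedFourierIntegral (p a : ℝ) (μ : Measure (EuclideanSpace ℝ (Fin d))) :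
    ℝ≥0∞ :=
  ∫⁻ z, ‖fourierTransformMeasure μ z‖ₑ ^ p * ENNReal.ofReal ((1 + ‖z‖) ^ a)

/-- The measure `exp (-π |x|²) dμ(x)`. Its Fourier transform is the convolution of `μ̂` with a
Gaussian. -/
noncomputable def gaussianDamping (μ : Measure (EuclideanSpace ℝ (Fin d))) :
    Measure (EuclideanSpace ℝ (Fin d)) :=
  μ.withDensity fun x => ENNReal.ofReal (Real.exp (-Real.pi * ‖x‖ ^ 2))

lemma rpow_le_rpow_abs_mul_rpow {x y κ : ℝ} (a : ℝ) (hx : 0 < x) (hy : 0 < y) (hκ : 0 < κ)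
    (h1 : x ≤ κ * y) (h2 : y ≤ κ * x) : x ^ a ≤ κ ^ |a| * y ^ a := by
  rcases le_total 0 a with ha | ha
  · rw [abs_of_nonneg ha, ← Real.mul_rpow hκ.le hy.le]
    exact Real.rpow_le_rpow hx.le h1 ha
  · rw [abs_of_nonpos ha, Real.rpow_neg hκ.le, ← Real.inv_rpow hκ.le,
      ← Real.mul_rpow (by positivity) hy.le]
    refine Real.rpow_le_rpow_of_nonpos (by positivity) ?_ ha
    rw [inv_mul_le_iff₀ hκ]
    exact h2

lemma lintegral_mul_lt_top_of_le_on_compl_ball {F v w : EuclideanSpace ℝ (Fin d) → ℝ≥0∞}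
    {M C : ℝ≥0∞} (hC : C ≠ ∞) (hM : M ≠ ∞) (hF : ∀ z, F z ≤ M)
    (hv : ∫⁻ z in Metric.ball 0 1, v z < ∞)
    (hvw : ∀ z, 1 ≤ ‖z‖ → v z ≤ C * w z) (h : ∫⁻ z, F z * w z < ∞) : ∫⁻ z, F z * v z < ∞ := by
  rw [← lintegral_add_compl _ (measurableSet_ball (x := (0 : EuclideanSpace ℝ (Fin d))) (ε := 1))]
  refine ENNReal.add_lt_top.2 ⟨?_, ?_⟩
  · calc _ ≤ ∫⁻ z in Metric.ball 0 1, M * v z := lintegral_mono fun z => by gcongr; exact hF z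
      _ = M * ∫⁻ z in Metric.ball 0 1, v z := lintegral_const_mul' _ _ hM
      _ < ∞ := ENNReal.mul_lt_top hM.lt_top hv
  · calc _ ≤ ∫⁻ z in (Metric.ball 0 1)ᶜ, C * (F z * w z) := by
          refine setLIntegral_mono' measurableSet_ball.compl fun z hz => ?_
          have hz : 1 ≤ ‖z‖ := by simpa using hz
          calc F z * v z ≤ F z * (C * w z) := by gcongr; exact hvw z hz
            _ = _ := by ring
      _ ≤ ∫⁻ z, C * (F z * w z) := setLIntegral_le_lintegral _ _
      _ = C * ∫⁻ z, F z * w z := lintegral_const_mul' _ _ hC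
      _ < ∞ := ENNReal.mul_lt_top hC.lt_top h

lemma setLIntegral_ball_enorm_rpow_lt_top (hd : 0 < d) {a : ℝ} (ha : -(d : ℝ) < a) :
    ∫⁻ z in Metric.ball (0 : EuclideanSpace ℝ (Fin d)) 1, ‖z‖ₑ ^ a < ∞ := by
  have : Nonempty (Fin d) := ⟨⟨0, hd⟩⟩
  have h : IntegrableOn (fun z : EuclideanSpace ℝ (Fin d) => ‖z‖ ^ a) (Metric.ball 0 1) := by
    refine integrableOn_ball_of_norm_le_rpow (μ := volume) (C := 1) (α := -a)
      (by rw [finrank_euclideanSpace_fin]; exact hd) (by simp; linarith)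
      (Eventually.of_forall fun z => ?_)
      (Measurable.aestronglyMeasurable (by fun_prop))
    rw [Real.norm_of_nonneg (by positivity), neg_neg, one_mul]
  have hne : ∀ᵐ z : EuclideanSpace ℝ (Fin d), z ≠ 0 := by simp [ae_iff]
  refine lt_of_le_of_lt (le_of_eq ?_) h.2
  refine lintegral_congr_ae ((ae_restrict_of_ae hne).mono fun z hz => ?_)
  simp only
  rw [Real.enorm_of_nonneg (by positivity), ← ofReal_norm,
    ENNReal.ofReal_rpow_of_pos (norm_pos_iff.2 hz)]

lemma setLIntegral_ball_one_add_norm_rpow_lt_top (a : ℝ) :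
    ∫⁻ z in Metric.ball (0 : EuclideanSpace ℝ (Fin d)) 1,
      ENNReal.ofReal ((1 + ‖z‖) ^ a) < ∞ := by
  calc _ ≤ ∫⁻ z in Metric.ball (0 : EuclideanSpace ℝ (Fin d)) 1, ENNReal.ofReal (2 ^ |a|) := by
        refine setLIntegral_mono' measurableSet_ball fun z hz => ENNReal.ofReal_le_ofReal ?_
        have hz : ‖z‖ < 1 := by simpa using hz
        have hz0 := norm_nonneg z
        simpa using rpow_le_rpow_abs_mul_rpow (x := 1 + ‖z‖) (y := 1) (κ := 2) a (by positivity)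
          one_pos two_pos (by linarith) (by linarith)
    _ < ∞ := by
        rw [setLIntegral_const]
        exact ENNReal.mul_lt_top ENNReal.ofReal_lt_top measure_ball_lt_top

lemma enorm_rpow_eq_ofReal {z : EuclideanSpace ℝ (Fin d)} (hz : 1 ≤ ‖z‖) (a : ℝ) :
    ‖z‖ₑ ^ a = ENNReal.ofReal (‖z‖ ^ a) := by
  rw [← ofReal_norm, ENNReal.ofReal_rpow_of_pos (by linarith)]

lemma one_add_norm_rpow_le {z : EuclideanSpace ℝ (Fin d)} (hz : 1 ≤ ‖z‖) (a : ℝ) :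
    ENNReal.ofReal ((1 + ‖z‖) ^ a) ≤ ENNReal.ofReal (2 ^ |a|) * ‖z‖ₑ ^ a := by
  rw [enorm_rpow_eq_ofReal hz, ← ENNReal.ofReal_mul (by positivity)]
  exact ENNReal.ofReal_le_ofReal (rpow_le_rpow_abs_mul_rpow a (by linarith) (by linarith) two_pos
    (by linarith) (by linarith))

lemma enorm_rpow_le {z : EuclideanSpace ℝ (Fin d)} (hz : 1 ≤ ‖z‖) (a : ℝ) :
    ‖z‖ₑ ^ a ≤ ENNReal.ofReal (2 ^ |a|) * ENNReal.ofReal ((1 + ‖z‖) ^ a) := by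
  rw [enorm_rpow_eq_ofReal hz, ← ENNReal.ofReal_mul (by positivity)]
  exact ENNReal.ofReal_le_ofReal (rpow_le_rpow_abs_mul_rpow a (by linarith) (by linarith) two_pos
    (by linarith) (by linarith))

lemma fourierEnergy_lt_top_iff (hd : 0 < d) {s θ : ℝ} (hs : 0 < s) (hθ : 0 < θ)
    (μ : Measure (EuclideanSpace ℝ (Fin d))) [IsFiniteMeasure μ] :
    fourierEnergy s θ μ < ∞ ↔ weightedFourierIntegral (2 / θ) (s / θ - d) μ < ∞ := by
  rw [fourierEnergy, if_neg hθ.ne', ENNReal.rpow_lt_top_iff_of_pos hθ, weightedFourierIntegral]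
  have hM : (μ univ) ^ (2 / θ) ≠ ∞ :=
    ENNReal.rpow_ne_top_of_nonneg (by positivity) (measure_ne_top μ univ)
  have hF : ∀ z, ‖fourierTransformMeasure μ z‖ₑ ^ (2 / θ) ≤ (μ univ) ^ (2 / θ) := fun z => by
    gcongr; exact enorm_fourierTransformMeasure_le μ z
  constructor
  · exact lintegral_mul_lt_top_of_le_on_compl_ball ENNReal.ofReal_ne_top hM hF
      (setLIntegral_ball_one_add_norm_rpow_lt_top _) fun z hz => one_add_norm_rpow_le hz _
  · refine lintegral_mul_lt_top_of_le_on_compl_ball ENNReal.ofReal_ne_top hM hF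
      (setLIntegral_ball_enorm_rpow_lt_top hd ?_) fun z hz => enorm_rpow_le hz _
    have : 0 < s / θ := by positivity
    linarith

lemma weightedFourierIntegral_mono {p a b : ℝ} (hab : a ≤ b)
    (μ : Measure (EuclideanSpace ℝ (Fin d))) :
    weightedFourierIntegral p a μ ≤ weightedFourierIntegral p b μ := by
  refine lintegral_mono fun z => ?_
  gcongr
  linarith [norm_nonneg z]

instance (μ : Measure (EuclideanSpace ℝ (Fin d))) [IsFiniteMeasure μ] :
    IsFiniteMeasure (gaussianDamping μ) := by
  refine isFiniteMeasure_withDensity_ofReal ?_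
  refine (Integrable.of_bound (C := 1) (Continuous.aestronglyMeasurable (by fun_prop))
    (Eventually.of_forall fun x => ?_)).2
  rw [Real.norm_of_nonneg (by positivity)]
  refine Real.exp_le_one_iff.2 ?_
  have : 0 ≤ Real.pi * ‖x‖ ^ 2 := by positivity
  linarith

lemma gaussianDamping_ne_zero {μ : Measure (EuclideanSpace ℝ (Fin d))} (hμ : μ ≠ 0) :
    gaussianDamping μ ≠ 0 := by
  intro h
  have h1 : μ ≪ gaussianDamping μ := by
    refine withDensity_absolutelyContinuous' (Measurable.aemeasurable (by fun_prop)) ?_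
    exact Eventually.of_forall fun x => (ENNReal.ofReal_pos.2 (Real.exp_pos _)).ne'
  rw [h] at h1
  exact hμ (Measure.absolutelyContinuous_zero_iff.1 h1)

lemma support_gaussianDamping_subset (μ : Measure (EuclideanSpace ℝ (Fin d))) :
    (gaussianDamping μ).support ⊆ μ.support :=
  (withDensity_absolutelyContinuous μ _).support_mono

lemma integral_gaussian_mul_exp (x : EuclideanSpace ℝ (Fin d)) :
    ∫ w : EuclideanSpace ℝ (Fin d), Complex.exp (-(Real.pi : ℂ) * ‖w‖ ^ 2 +
      2 * Real.pi * Complex.I * (inner ℝ x w : ℝ)) = Real.exp (-Real.pi * ‖x‖ ^ 2) := by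
  rw [GaussianFourier.integral_cexp_neg_mul_sq_norm_add
    (by rw [Complex.ofReal_re]; exact Real.pi_pos)]
  have hpi : (Real.pi : ℂ) ≠ 0 := by exact_mod_cast Real.pi_ne_zero
  rw [div_self hpi, Complex.one_cpow, one_mul, Complex.ofReal_exp]
  congr 1
  push_cast
  field_simp
  rw [Complex.I_sq]; ring

lemma fourierTransformMeasure_gaussianDamping (μ : Measure (EuclideanSpace ℝ (Fin d)))
    [IsFiniteMeasure μ] (z : EuclideanSpace ℝ (Fin d)) :
    fourierTransformMeasure (gaussianDamping μ) z =
      ∫ w, (Real.exp (-Real.pi * ‖w‖ ^ 2) : ℂ) * fourierTransformMeasure μ (z - w) := by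
  have h1 : fourierTransformMeasure (gaussianDamping μ) z =
      ∫ x, (Real.exp (-Real.pi * ‖x‖ ^ 2) : ℂ) *
        Complex.exp (-2 * Real.pi * Complex.I * (inner ℝ z x : ℝ)) ∂μ := by
    rw [fourierTransformMeasure, gaussianDamping, integral_withDensity_eq_integral_toReal_smul
      (by fun_prop) (Eventually.of_forall fun x => ENNReal.ofReal_lt_top)]
    refine integral_congr_ae (Eventually.of_forall fun x => ?_)
    simp only
    rw [ENNReal.toReal_ofReal (Real.exp_pos _).le, Complex.real_smul]
  calc _ = ∫ x, (∫ w : EuclideanSpace ℝ (Fin d), (Real.exp (-Real.pi * ‖w‖ ^ 2) : ℂ) *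
        Complex.exp (-2 * Real.pi * Complex.I * (inner ℝ (z - w) x : ℝ))) ∂μ := by
        rw [h1]
        refine integral_congr_ae (Eventually.of_forall fun x => ?_)
        simp only
        rw [← integral_gaussian_mul_exp, ← integral_mul_const]
        refine integral_congr_ae (Eventually.of_forall fun w => ?_)
        simp only [Complex.ofReal_exp, ← Complex.exp_add]
        congr 1
        rw [inner_sub_left, real_inner_comm w x]
        push_cast; ring
    _ = ∫ w : EuclideanSpace ℝ (Fin d), ∫ x, (Real.exp (-Real.pi * ‖w‖ ^ 2) : ℂ) *
        Complex.exp (-2 * Real.pi * Complex.I * (inner ℝ (z - w) x : ℝ)) ∂μ := by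
        refine integral_integral_swap ?_
        have h := (integrable_const (μ := μ) (1 : ℝ)).mul_prod
          (integrable_exp_neg_mul_norm_sq (d := d) Real.pi_pos)
        refine h.mono' (Continuous.aestronglyMeasurable (by unfold Function.uncurry; fun_prop))
          (Eventually.of_forall fun q => ?_)
        simp only [Function.uncurry]
        rw [norm_mul, norm_exp_two_pi_mul_I, Complex.norm_real, Real.norm_of_nonneg (by positivity)]
        simp
    _ = _ := by
        refine integral_congr_ae (Eventually.of_forall fun w => ?_)
        simp only [fourierTransformMeasure]
        rw [integral_const_mul]

lemma lintegral_gaussian :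
    ∫⁻ w : EuclideanSpace ℝ (Fin d), ENNReal.ofReal (Real.exp (-Real.pi * ‖w‖ ^ 2)) = 1 := by
  rw [← ofReal_integral_eq_lintegral_ofReal (integrable_exp_neg_mul_norm_sq Real.pi_pos)
    (Eventually.of_forall fun w => (Real.exp_pos _).le),
    GaussianFourier.integral_rexp_neg_mul_sq_norm Real.pi_pos]
  simp [Real.pi_ne_zero]

/-- Jensen's inequality for the convolution of `μ̂` with the Gaussian probability density. -/
lemma enorm_fourierTransformMeasure_gaussianDamping_rpow_le {p : ℝ} (hp : 1 ≤ p)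
    (μ : Measure (EuclideanSpace ℝ (Fin d))) [IsFiniteMeasure μ]
    (z : EuclideanSpace ℝ (Fin d)) :
    ‖fourierTransformMeasure (gaussianDamping μ) z‖ₑ ^ p ≤
      ∫⁻ w, ENNReal.ofReal (Real.exp (-Real.pi * ‖z - w‖ ^ 2)) *
        ‖fourierTransformMeasure μ w‖ₑ ^ p := by
  have hp0 : 0 < p := by linarith
  have hm := (continuous_fourierTransformMeasure μ).measurable
  set g : EuclideanSpace ℝ (Fin d) → ℝ≥0∞ :=
    fun w => ENNReal.ofReal (Real.exp (-Real.pi * ‖z - w‖ ^ 2))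
  have hg1 : ∫⁻ w, g w = 1 := by
    rw [← lintegral_gaussian (d := d)]
    exact lintegral_sub_left_eq_self
      (fun w : EuclideanSpace ℝ (Fin d) => ENNReal.ofReal (Real.exp (-Real.pi * ‖w‖ ^ 2))) z
  have hg0 : ∀ w, g w ≠ 0 := fun w => (ENNReal.ofReal_pos.2 (Real.exp_pos _)).ne'
  have hgtop : ∀ w, g w ≠ ∞ := fun w => ENNReal.ofReal_ne_top
  have h1 : ‖fourierTransformMeasure (gaussianDamping μ) z‖ₑ ≤
      ∫⁻ w, g w * ‖fourierTransformMeasure μ w‖ₑ := by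
    rw [fourierTransformMeasure_gaussianDamping]
    refine (enorm_integral_le_lintegral_enorm _).trans (le_of_eq ?_)
    rw [← lintegral_sub_left_eq_self _ z]
    refine lintegral_congr fun w => ?_
    rw [enorm_mul, sub_sub_cancel, ← ofReal_norm, Complex.norm_real,
      Real.norm_of_nonneg (Real.exp_pos _).le]
  have h2 : ∫⁻ w, g w * ‖fourierTransformMeasure μ w‖ₑ ≤
      (∫⁻ w, g w * ‖fourierTransformMeasure μ w‖ₑ ^ p) ^ p⁻¹ := by
    calc _ = ∫⁻ w, (g w * ‖fourierTransformMeasure μ w‖ₑ ^ p) ^ p⁻¹ * g w ^ (1 - p⁻¹) := by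
          refine lintegral_congr fun w => ?_
          rw [ENNReal.mul_rpow_of_nonneg _ _ (by positivity), ← ENNReal.rpow_mul,
            mul_inv_cancel₀ hp0.ne', ENNReal.rpow_one, mul_right_comm,
            ← ENNReal.rpow_add _ _ (hg0 w) (hgtop w)]
          simp
      _ ≤ (∫⁻ w, g w * ‖fourierTransformMeasure μ w‖ₑ ^ p) ^ p⁻¹ *
          (∫⁻ w, g w) ^ (1 - p⁻¹) := by
          refine ENNReal.lintegral_mul_norm_pow_le (Measurable.aemeasurable (by fun_prop))
            (Measurable.aemeasurable (by fun_prop)) (by positivity) ?_ (by ring)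
          rw [sub_nonneg]
          exact inv_le_one_of_one_le₀ hp
      _ = _ := by rw [hg1, ENNReal.one_rpow, mul_one]
  rw [← ENNReal.le_rpow_inv_iff hp0]
  exact h1.trans h2

lemma exists_exp_mul_one_add_rpow_le (m : ℝ) :
    ∃ C : ℝ, 0 < C ∧ ∀ r : ℝ, 0 ≤ r → Real.exp (-Real.pi * r ^ 2) * (1 + r) ^ m ≤ C := by
  obtain ⟨n, hn⟩ := exists_nat_ge m
  refine ⟨n.factorial * Real.exp 2, by positivity, fun r hr => ?_⟩
  have h1 : (1 + r) ^ m ≤ n.factorial * Real.exp (1 + r) := by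
    calc (1 + r) ^ m ≤ (1 + r) ^ (n : ℝ) := Real.rpow_le_rpow_of_exponent_le (by linarith) hn
      _ = (1 + r) ^ n := Real.rpow_natCast _ _
      _ ≤ _ := by
        have := Real.pow_div_factorial_le_exp (1 + r) (by linarith) n
        rw [div_le_iff₀ (by positivity)] at this
        linarith
  calc Real.exp (-Real.pi * r ^ 2) * (1 + r) ^ m
      ≤ Real.exp (-Real.pi * r ^ 2) * (n.factorial * Real.exp (1 + r)) := by gcongr
    _ = n.factorial * Real.exp (-Real.pi * r ^ 2 + (1 + r)) := by
        rw [Real.exp_add (-Real.pi * r ^ 2)]; ring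
    _ ≤ n.factorial * Real.exp 2 := by
        gcongr
        nlinarith [Real.pi_gt_three, sq_nonneg (r - 1), sq_nonneg r]

lemma lintegral_one_add_norm_rpow_lt_top {m : ℝ} (hm : d < m) :
    ∫⁻ z : EuclideanSpace ℝ (Fin d), ENNReal.ofReal ((1 + ‖z‖) ^ (-m)) < ∞ := by
  have h := integrable_one_add_norm (E := EuclideanSpace ℝ (Fin d)) (μ := volume) (r := m)
    (by simpa using hm)
  refine lt_of_le_of_lt (le_of_eq (lintegral_congr fun z => ?_)) h.2
  rw [Real.enorm_of_nonneg (by positivity)]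

/-- Gaussian damping turns an integral bound on `|μ̂|^p (1 + |z|)^a` into a uniform bound, and
preserves the integral bound, by `(1 + |z|)^a ≤ (1 + |z - w|)^|a| (1 + |w|)^a`. -/
lemma gaussianDamping_bounds {p a : ℝ} (hp : 1 ≤ p)
    {μ : Measure (EuclideanSpace ℝ (Fin d))} [IsFiniteMeasure μ]
    (h : weightedFourierIntegral p a μ < ∞) :
    weightedFourierIntegral p a (gaussianDamping μ) < ∞ ∧ ∃ C : ℝ≥0∞, C ≠ ∞ ∧ ∀ z,
      ‖fourierTransformMeasure (gaussianDamping μ) z‖ₑ ^ p *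
        ENNReal.ofReal ((1 + ‖z‖) ^ a) ≤ C := by
  have hm := (continuous_fourierTransformMeasure μ).measurable
  obtain ⟨C, hC0, hC⟩ := exists_exp_mul_one_add_rpow_le (|a| + (d + 1))
  set F : EuclideanSpace ℝ (Fin d) → ℝ≥0∞ := fun w =>
    ‖fourierTransformMeasure μ w‖ₑ ^ p * ENNReal.ofReal ((1 + ‖w‖) ^ a) with hFdef
  have hFm : Measurable F := by fun_prop
  let k : EuclideanSpace ℝ (Fin d) → ℝ≥0∞ := fun v =>
    ENNReal.ofReal C * ENNReal.ofReal ((1 + ‖v‖) ^ (-((d : ℝ) + 1)))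
  have hkm : Measurable k := by fun_prop
  have hpt : ∀ z, ‖fourierTransformMeasure (gaussianDamping μ) z‖ₑ ^ p *
      ENNReal.ofReal ((1 + ‖z‖) ^ a) ≤ ∫⁻ w, k (z - w) * F w := by
    intro z
    calc _ ≤ (∫⁻ w, ENNReal.ofReal (Real.exp (-Real.pi * ‖z - w‖ ^ 2)) *
            ‖fourierTransformMeasure μ w‖ₑ ^ p) * ENNReal.ofReal ((1 + ‖z‖) ^ a) := by
          gcongr
          exact enorm_fourierTransformMeasure_gaussianDamping_rpow_le hp μ z
      _ = ∫⁻ w, (ENNReal.ofReal (Real.exp (-Real.pi * ‖z - w‖ ^ 2)) *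
            ‖fourierTransformMeasure μ w‖ₑ ^ p) * ENNReal.ofReal ((1 + ‖z‖) ^ a) :=
          (lintegral_mul_const' _ _ ENNReal.ofReal_ne_top).symm
      _ ≤ _ := by
          refine lintegral_mono fun w => ?_
          have h1 : (1 + ‖z‖) ^ a ≤ (1 + ‖z - w‖) ^ |a| * (1 + ‖w‖) ^ a := by
            have hz := norm_nonneg z
            have hw := norm_nonneg w
            have hzw := norm_nonneg (z - w)
            have t1 : ‖z‖ ≤ ‖z - w‖ + ‖w‖ := by simpa using norm_add_le (z - w) w
            have t2 : ‖w‖ ≤ ‖z - w‖ + ‖z‖ := by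
              rw [norm_sub_rev]; simpa using norm_add_le (w - z) z
            refine rpow_le_rpow_abs_mul_rpow a (by positivity) (by positivity) (by positivity) ?_ ?_
            · nlinarith [mul_nonneg hzw hw]
            · nlinarith [mul_nonneg hzw hz]
          have h2 : Real.exp (-Real.pi * ‖z - w‖ ^ 2) * (1 + ‖z - w‖) ^ |a| ≤
              C * (1 + ‖z - w‖) ^ (-((d : ℝ) + 1)) := by
            have h3 := hC ‖z - w‖ (norm_nonneg _)
            have h4 : (0 : ℝ) < 1 + ‖z - w‖ := by positivity
            rw [Real.rpow_add h4, ← mul_assoc] at h3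
            rw [Real.rpow_neg h4.le, ← div_eq_mul_inv, le_div_iff₀ (by positivity)]
            exact h3
          calc _ ≤ (ENNReal.ofReal (Real.exp (-Real.pi * ‖z - w‖ ^ 2)) *
                ‖fourierTransformMeasure μ w‖ₑ ^ p) *
                  ENNReal.ofReal ((1 + ‖z - w‖) ^ |a| * (1 + ‖w‖) ^ a) := by gcongr
            _ = ENNReal.ofReal (Real.exp (-Real.pi * ‖z - w‖ ^ 2) * (1 + ‖z - w‖) ^ |a|) * F w := by
                rw [hFdef, ENNReal.ofReal_mul (by positivity), ENNReal.ofReal_mul (by positivity)]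
                ring
            _ ≤ ENNReal.ofReal (C * (1 + ‖z - w‖) ^ (-((d : ℝ) + 1))) * F w := by gcongr
            _ = k (z - w) * F w := by rw [ENNReal.ofReal_mul hC0.le]
  have hkint : ∫⁻ v, k v < ∞ := by
    rw [lintegral_const_mul' _ _ ENNReal.ofReal_ne_top]
    exact ENNReal.mul_lt_top ENNReal.ofReal_lt_top
      (lintegral_one_add_norm_rpow_lt_top (by linarith))
  constructor
  · calc weightedFourierIntegral p a (gaussianDamping μ)
        ≤ ∫⁻ z, ∫⁻ w, k (z - w) * F w := lintegral_mono hpt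
      _ = ∫⁻ w, ∫⁻ z, k (z - w) * F w := by
          refine lintegral_lintegral_swap (Measurable.aemeasurable ?_)
          unfold Function.uncurry
          fun_prop
      _ = ∫⁻ w, (∫⁻ v, k v) * F w := by
          refine lintegral_congr fun w => ?_
          rw [lintegral_mul_const _ (by fun_prop), lintegral_sub_right_eq_self k w]
      _ = (∫⁻ v, k v) * ∫⁻ w, F w := lintegral_const_mul _ hFm
      _ < ∞ := ENNReal.mul_lt_top hkint h
  · refine ⟨ENNReal.ofReal C * ∫⁻ w, F w, (ENNReal.mul_lt_top ENNReal.ofReal_lt_top h).ne,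
      fun z => (hpt z).trans ?_⟩
    rw [← lintegral_const_mul _ hFm]
    refine lintegral_mono fun w => ?_
    gcongr
    refine mul_le_of_le_one_right zero_le ?_
    rw [ENNReal.ofReal_le_one]
    exact Real.rpow_le_one_of_one_le_of_nonpos (by linarith [norm_nonneg (z - w)])
      (by linarith [(Nat.cast_nonneg d : (0 : ℝ) ≤ d)])

end Damping

/-! ### The Fourier spectrum as a function of `θ` -/

section Spectrum

open Filter Topology

variable {d : ℕ}

lemma le_fourierSpectrumSet {θ : ℝ} {X : Set (EuclideanSpace ℝ (Fin d))}
    {μ : Measure (EuclideanSpace ℝ (Fin d))} [IsFiniteMeasure μ] (hμ : μ ≠ 0)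
    (hX : μ.support ⊆ X) {s : ℝ≥0} (hs : fourierEnergy s θ μ < ∞) :
    min (s : ℝ≥0∞) d ≤ fourierSpectrumSet θ X := by
  refine le_trans ?_ (le_iSup₂ (f := fun (μ : Measure (EuclideanSpace ℝ (Fin d)))
    (_ : IsFiniteMeasure μ ∧ μ ≠ 0 ∧ μ.support ⊆ X) =>
      min (fourierSpectrumMeasure θ μ) (d : ℝ≥0∞)) μ ⟨inferInstance, hμ, hX⟩)
  gcongr
  exact le_iSup₂ (f := fun (s : ℝ≥0) (_ : fourierEnergy (s : ℝ) θ μ < ∞) => (s : ℝ≥0∞)) s hs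

lemma fourierSpectrumSet_le_of_forall {θ : ℝ} {X : Set (EuclideanSpace ℝ (Fin d))} {B : ℝ≥0∞}
    (h : ∀ (μ : Measure (EuclideanSpace ℝ (Fin d))) [IsFiniteMeasure μ], μ ≠ 0 → μ.support ⊆ X →
      ∀ s : ℝ≥0, fourierEnergy s θ μ < ∞ → min (s : ℝ≥0∞) d ≤ B) :
    fourierSpectrumSet θ X ≤ B := by
  refine iSup₂_le fun μ ⟨hfin, hμ, hX⟩ => ?_
  rw [fourierSpectrumMeasure, iSup₂_inf_eq]
  exact iSup₂_le fun s hs => h μ hμ hX s hs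

lemma one_add_norm_pos (z : EuclideanSpace ℝ (Fin d)) : 0 < 1 + ‖z‖ := by positivity

lemma ofReal_one_add_norm_rpow_rpow (z : EuclideanSpace ℝ (Fin d)) (a b : ℝ) :
    ENNReal.ofReal ((1 + ‖z‖) ^ a) ^ b = ENNReal.ofReal ((1 + ‖z‖) ^ (a * b)) := by
  have := one_add_norm_pos z
  rw [ENNReal.ofReal_rpow_of_pos (by positivity), ← Real.rpow_mul this.le]

/-- Damping a measure costs at most `d (θ' - θ)` when passing from `θ'` to `θ ≤ θ'`: interpolate
between the integral bound and the uniform bound of `gaussianDamping_bounds`. -/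
lemma fourierEnergy_gaussianDamping_lt_top (hd : 0 < d) {s s' θ θ' : ℝ} (hθ : 0 ≤ θ) (hθθ' : θ < θ')
    (hθ' : θ' ≤ 1) (hs' : 0 < s') (hss' : s' = s - d * (θ' - θ))
    {μ : Measure (EuclideanSpace ℝ (Fin d))} [IsFiniteMeasure μ] (h : fourierEnergy s θ' μ < ∞) :
    fourierEnergy s' θ (gaussianDamping μ) < ∞ := by
  have hθ'0 : 0 < θ' := hθ.trans_lt hθθ'
  have hd' : (0 : ℝ) < d := by exact_mod_cast hd
  have hs : 0 < s := by nlinarith [mul_pos hd' (sub_pos.2 hθθ')]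
  have hp : 1 ≤ 2 / θ' := by rw [le_div_iff₀ hθ'0]; linarith
  obtain ⟨hW, C, hC, hbound⟩ := gaussianDamping_bounds hp
    ((fourierEnergy_lt_top_iff hd hs hθ'0 μ).1 h)
  set ν := gaussianDamping μ
  rcases hθ.eq_or_lt with rfl | hθ0
  · rw [fourierEnergy, if_pos rfl]
    refine lt_of_le_of_lt (iSup_le fun z => ?_) (ENNReal.rpow_lt_top_of_nonneg hθ'0.le hC)
    have h1 := ENNReal.rpow_le_rpow (hbound z) hθ'0.le
    rw [ENNReal.mul_rpow_of_nonneg _ _ hθ'0.le, ← ENNReal.rpow_mul, div_mul_cancel₀ _ hθ'0.ne',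
      ofReal_one_add_norm_rpow_rpow] at h1
    refine le_trans ?_ h1
    gcongr
    have h2 : (s / θ' - d) * θ' = s' := by rw [hss']; field_simp; ring
    rw [h2, ← ofReal_norm, ENNReal.ofReal_rpow_of_nonneg (norm_nonneg z) hs'.le]
    refine ENNReal.ofReal_le_ofReal ?_
    gcongr
    linarith
  · rw [fourierEnergy_lt_top_iff hd hs' hθ0]
    have hk : 0 ≤ θ' / θ - 1 := by rw [sub_nonneg, le_div_iff₀ hθ0]; linarith
    have hk1 : 0 ≤ θ' / θ := by positivity
    have he : ∀ z, ‖fourierTransformMeasure ν z‖ₑ ^ (2 / θ) *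
        ENNReal.ofReal ((1 + ‖z‖) ^ (s' / θ - d)) =
        (‖fourierTransformMeasure ν z‖ₑ ^ (2 / θ') *
          ENNReal.ofReal ((1 + ‖z‖) ^ (s / θ' - d))) ^ (θ' / θ) := by
      intro z
      rw [ENNReal.mul_rpow_of_nonneg _ _ hk1, ← ENNReal.rpow_mul, ofReal_one_add_norm_rpow_rpow]
      congr 2
      · field_simp
      · rw [hss']; congr 1; field_simp; ring
    calc weightedFourierIntegral (2 / θ) (s' / θ - d) ν
        ≤ ∫⁻ z, C ^ (θ' / θ - 1) * (‖fourierTransformMeasure ν z‖ₑ ^ (2 / θ') *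
          ENNReal.ofReal ((1 + ‖z‖) ^ (s / θ' - d))) := by
          refine lintegral_mono fun z => ?_
          simp only
          rw [he z]
          set G := ‖fourierTransformMeasure ν z‖ₑ ^ (2 / θ') *
            ENNReal.ofReal ((1 + ‖z‖) ^ (s / θ' - d))
          calc G ^ (θ' / θ) = G ^ ((θ' / θ - 1) + 1) := by rw [sub_add_cancel]
            _ = G ^ (θ' / θ - 1) * G := by
              rw [ENNReal.rpow_add_of_nonneg _ _ hk zero_le_one, ENNReal.rpow_one]
            _ ≤ C ^ (θ' / θ - 1) * G := by gcongr; exact hbound z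
      _ = C ^ (θ' / θ - 1) * weightedFourierIntegral (2 / θ') (s / θ' - d) ν :=
          lintegral_const_mul' _ _ (ENNReal.rpow_ne_top_of_nonneg hk hC)
      _ < ∞ := ENNReal.mul_lt_top (ENNReal.rpow_lt_top_of_nonneg hk hC) hW

lemma fourierSpectrumSet_le_add (hd : 0 < d) {θ θ' : ℝ} (hθ : 0 ≤ θ) (hθθ' : θ < θ')
    (hθ' : θ' ≤ 1) (X : Set (EuclideanSpace ℝ (Fin d))) :
    fourierSpectrumSet θ' X ≤ fourierSpectrumSet θ X + ENNReal.ofReal (d * (θ' - θ)) := by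
  refine fourierSpectrumSet_le_of_forall fun μ _ hμ hX s hs => ?_
  rcases le_or_gt (s : ℝ) (d * (θ' - θ)) with h | h
  · refine (min_le_left _ _).trans (le_trans ?_ le_add_self)
    rw [← ENNReal.ofReal_coe_nnreal]
    exact ENNReal.ofReal_le_ofReal h
  · obtain ⟨s', hss'⟩ : ∃ s' : ℝ≥0, (s' : ℝ) = s - d * (θ' - θ) :=
      ⟨⟨_, (sub_pos.2 h).le⟩, rfl⟩
    have hs' : 0 < (s' : ℝ) := hss' ▸ sub_pos.2 h
    have h1 := fourierEnergy_gaussianDamping_lt_top hd hθ hθθ' hθ' hs' hss' hs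
    have h2 := le_fourierSpectrumSet (gaussianDamping_ne_zero hμ)
      ((support_gaussianDamping_subset μ).trans hX) h1
    have hsplit : (s : ℝ≥0∞) = s' + ENNReal.ofReal (d * (θ' - θ)) := by
      have hd0 : (0 : ℝ) ≤ d * (θ' - θ) := mul_nonneg (Nat.cast_nonneg d) (by linarith)
      rw [← ENNReal.ofReal_coe_nnreal, ← ENNReal.ofReal_coe_nnreal (p := s'),
        ← ENNReal.ofReal_add hs'.le hd0, hss', sub_add_cancel]
    calc min (s : ℝ≥0∞) d ≤ min (s' : ℝ≥0∞) d + ENNReal.ofReal (d * (θ' - θ)) := by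
          rw [min_add]
          exact le_min ((min_le_left _ _).trans hsplit.le) ((min_le_right _ _).trans le_self_add)
      _ ≤ _ := by gcongr

/-- Up to an arbitrarily small loss in `s`, finiteness of the energy passes from `θ` to
`θ' > θ`, by Hölder's inequality. -/
lemma fourierEnergy_lt_top_of_lt (hd : 0 < d) {s s' θ θ' : ℝ} (hθ : 0 ≤ θ) (hθθ' : θ < θ')
    (hs' : 0 < s') (hss' : s' < s)
    {μ : Measure (EuclideanSpace ℝ (Fin d))} [IsFiniteMeasure μ] (h : fourierEnergy s θ μ < ∞) :
    fourierEnergy s' θ' μ < ∞ := by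
  have hθ'0 : 0 < θ' := hθ.trans_lt hθθ'
  have hs : 0 < s := hs'.trans hss'
  have hm := (continuous_fourierTransformMeasure μ).measurable
  rw [fourierEnergy_lt_top_iff hd hs' hθ'0]
  rcases hθ.eq_or_lt with rfl | hθ0
  · rw [fourierEnergy, if_pos rfl] at h
    set M := ⨆ z : EuclideanSpace ℝ (Fin d),
      ‖fourierTransformMeasure μ z‖ₑ ^ (2 : ℝ) * ‖z‖ₑ ^ s
    have hpt : ∀ z, 1 ≤ ‖z‖ → ‖fourierTransformMeasure μ z‖ₑ ^ (2 / θ') *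
        ENNReal.ofReal ((1 + ‖z‖) ^ (s' / θ' - d)) ≤
        ENNReal.ofReal (2 ^ |s / θ'|) * M ^ (1 / θ') *
          ENNReal.ofReal ((1 + ‖z‖) ^ (-(d + (s - s') / θ'))) := by
      intro z hz
      have h1 : ‖fourierTransformMeasure μ z‖ₑ ^ (2 : ℝ) * ‖z‖ₑ ^ s ≤ M := le_iSup
        (fun z => ‖fourierTransformMeasure μ z‖ₑ ^ (2 : ℝ) * ‖z‖ₑ ^ s) z
      have h2 := ENNReal.rpow_le_rpow h1 (show 0 ≤ 1 / θ' by positivity)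
      rw [ENNReal.mul_rpow_of_nonneg _ _ (by positivity), ← ENNReal.rpow_mul,
        ← ENNReal.rpow_mul, mul_one_div, mul_one_div] at h2
      have hpos := one_add_norm_pos z
      have h3 : (1 + ‖z‖) ^ (s' / θ' - d) =
          (1 + ‖z‖) ^ (s / θ') * (1 + ‖z‖) ^ (-(d + (s - s') / θ')) := by
        rw [← Real.rpow_add hpos]; congr 1; field_simp; ring
      rw [h3, ENNReal.ofReal_mul (by positivity), ← mul_assoc]
      gcongr ?_ * _
      calc _ ≤ ‖fourierTransformMeasure μ z‖ₑ ^ (2 / θ') *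
            (ENNReal.ofReal (2 ^ |s / θ'|) * ‖z‖ₑ ^ (s / θ')) := by
            gcongr; exact one_add_norm_rpow_le hz _
        _ = ENNReal.ofReal (2 ^ |s / θ'|) *
            (‖fourierTransformMeasure μ z‖ₑ ^ (2 / θ') * ‖z‖ₑ ^ (s / θ')) := by ring
        _ ≤ _ := mul_le_mul_right h2 _
    rw [weightedFourierIntegral, ← lintegral_add_compl _
      (measurableSet_ball (x := (0 : EuclideanSpace ℝ (Fin d))) (ε := 1))]
    refine ENNReal.add_lt_top.2 ⟨?_, ?_⟩
    · have hM : (μ univ) ^ (2 / θ') ≠ ∞ :=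
        ENNReal.rpow_ne_top_of_nonneg (by positivity) (measure_ne_top μ univ)
      calc _ ≤ ∫⁻ z in Metric.ball (0 : EuclideanSpace ℝ (Fin d)) 1, (μ univ) ^ (2 / θ') *
            ENNReal.ofReal ((1 + ‖z‖) ^ (s' / θ' - d)) := by
            refine lintegral_mono fun z => ?_
            gcongr
            exact enorm_fourierTransformMeasure_le μ z
        _ = _ := lintegral_const_mul' _ _ hM
        _ < ∞ := ENNReal.mul_lt_top hM.lt_top (setLIntegral_ball_one_add_norm_rpow_lt_top _)
    · have hc : ENNReal.ofReal (2 ^ |s / θ'|) * M ^ (1 / θ') < ∞ := ENNReal.mul_lt_top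
        ENNReal.ofReal_lt_top (ENNReal.rpow_lt_top_of_nonneg (by positivity) h.ne)
      calc _ ≤ ∫⁻ z in (Metric.ball (0 : EuclideanSpace ℝ (Fin d)) 1)ᶜ,
            ENNReal.ofReal (2 ^ |s / θ'|) * M ^ (1 / θ') *
              ENNReal.ofReal ((1 + ‖z‖) ^ (-(d + (s - s') / θ'))) :=
            setLIntegral_mono' measurableSet_ball.compl fun z hz => hpt z (by simpa using hz)
        _ ≤ ∫⁻ z, ENNReal.ofReal (2 ^ |s / θ'|) * M ^ (1 / θ') *
              ENNReal.ofReal ((1 + ‖z‖) ^ (-(d + (s - s') / θ'))) :=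
            setLIntegral_le_lintegral _ _
        _ = _ := lintegral_const_mul' _ _ hc.ne
        _ < ∞ := by
            refine ENNReal.mul_lt_top hc (lintegral_one_add_norm_rpow_lt_top ?_)
            have : 0 < (s - s') / θ' := div_pos (by linarith) hθ'0
            linarith
  · rw [fourierEnergy_lt_top_iff hd hs hθ0] at h
    -- the exponent of the weight in the second Hölder factor
    set m : ℝ := d + (s - s') / (θ' - θ) with hmdef
    have hmd : (d : ℝ) < m := by
      have : 0 < (s - s') / (θ' - θ) := div_pos (by linarith) (by linarith)
      linarith
    have hr0 : 0 ≤ θ / θ' := by positivity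
    have hr1 : 0 ≤ 1 - θ / θ' := by
      rw [sub_nonneg, div_le_one hθ'0]; exact hθθ'.le
    calc weightedFourierIntegral (2 / θ') (s' / θ' - d) μ
        = ∫⁻ z, (‖fourierTransformMeasure μ z‖ₑ ^ (2 / θ) *
            ENNReal.ofReal ((1 + ‖z‖) ^ (s / θ - d))) ^ (θ / θ') *
              ENNReal.ofReal ((1 + ‖z‖) ^ (-m)) ^ (1 - θ / θ') := by
          refine lintegral_congr fun z => ?_
          have hpos := one_add_norm_pos z
          rw [ENNReal.mul_rpow_of_nonneg _ _ hr0, ← ENNReal.rpow_mul,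
            ofReal_one_add_norm_rpow_rpow, ofReal_one_add_norm_rpow_rpow, mul_assoc,
            ← ENNReal.ofReal_mul (by positivity), ← Real.rpow_add hpos]
          have hne : θ' - θ ≠ 0 := by linarith
          congr 3
          · field_simp
          · rw [hmdef]; field_simp; ring
      _ ≤ (∫⁻ z, ‖fourierTransformMeasure μ z‖ₑ ^ (2 / θ) *
            ENNReal.ofReal ((1 + ‖z‖) ^ (s / θ - d))) ^ (θ / θ') *
          (∫⁻ z : EuclideanSpace ℝ (Fin d),
            ENNReal.ofReal ((1 + ‖z‖) ^ (-m))) ^ (1 - θ / θ') :=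
          ENNReal.lintegral_mul_norm_pow_le (Measurable.aemeasurable (by fun_prop))
            (Measurable.aemeasurable (by fun_prop)) hr0 hr1 (by ring)
      _ < ∞ := ENNReal.mul_lt_top (ENNReal.rpow_lt_top_of_nonneg hr0 h.ne)
          (ENNReal.rpow_lt_top_of_nonneg hr1 (lintegral_one_add_norm_rpow_lt_top hmd).ne)

lemma fourierSpectrumSet_mono (hd : 0 < d) {θ θ' : ℝ} (hθ : 0 ≤ θ) (hθθ' : θ < θ')
    (X : Set (EuclideanSpace ℝ (Fin d))) :
    fourierSpectrumSet θ X ≤ fourierSpectrumSet θ' X := by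
  refine fourierSpectrumSet_le_of_forall fun μ _ hμ hX s hs => ?_
  refine le_of_forall_lt fun r hr => ?_
  obtain ⟨s', hrs', hs'⟩ := ENNReal.lt_iff_exists_nnreal_btwn.1 hr
  refine hrs'.trans_le ?_
  rcases eq_or_ne s' 0 with rfl | h0
  · exact zero_le
  have hss' : s' < s := by exact_mod_cast hs'.trans_le (min_le_left _ _)
  have h1 := fourierEnergy_lt_top_of_lt hd hθ hθθ' (s' := s')
    (by exact_mod_cast pos_iff_ne_zero.2 h0) (by exact_mod_cast hss') hs
  refine le_trans (le_min le_rfl (hs'.le.trans (min_le_right _ _))) (le_fourierSpectrumSet hμ hX h1)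

lemma fourierEnergy_zero_lt_top_iff (s : ℝ≥0) (μ : Measure (EuclideanSpace ℝ (Fin d)))
    [IsFiniteMeasure μ] :
    fourierEnergy s 0 μ < ∞ ↔ ∃ C : ℝ, ∀ z : EuclideanSpace ℝ (Fin d), z ≠ 0 →
      ‖fourierTransformMeasure μ z‖ ≤ C * ‖z‖ ^ (-(s : ℝ) / 2) := by
  rw [fourierEnergy, if_pos rfl]
  have hof : ∀ z : EuclideanSpace ℝ (Fin d),
      ‖fourierTransformMeasure μ z‖ₑ ^ (2 : ℝ) * ‖z‖ₑ ^ (s : ℝ) =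
        ENNReal.ofReal (‖fourierTransformMeasure μ z‖ ^ 2 * ‖z‖ ^ (s : ℝ)) := by
    intro z
    rw [ENNReal.ofReal_mul (by positivity), ENNReal.ofReal_pow (norm_nonneg _),
      ← ENNReal.ofReal_rpow_of_nonneg (norm_nonneg z) (NNReal.coe_nonneg s), ofReal_norm,
      ofReal_norm]
    norm_cast
  simp only [hof]
  have hrpow : ∀ z : EuclideanSpace ℝ (Fin d), z ≠ 0 →
      (‖z‖ ^ (-(s : ℝ) / 2)) ^ 2 * ‖z‖ ^ (s : ℝ) = 1 := by
    intro z hz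
    have hz := norm_pos_iff.2 hz
    rw [← Real.rpow_natCast, ← Real.rpow_mul hz.le, ← Real.rpow_add hz]
    have : -(s : ℝ) / 2 * ((2 : ℕ) : ℝ) + s = 0 := by push_cast; ring
    rw [this, Real.rpow_zero]
  constructor
  · intro h
    set M := ⨆ z : EuclideanSpace ℝ (Fin d),
      ENNReal.ofReal (‖fourierTransformMeasure μ z‖ ^ 2 * ‖z‖ ^ (s : ℝ)) with hM
    refine ⟨Real.sqrt M.toReal, fun z hz => ?_⟩
    have h1 : ‖fourierTransformMeasure μ z‖ ^ 2 * ‖z‖ ^ (s : ℝ) ≤ M.toReal := by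
      rw [← ENNReal.ofReal_le_iff_le_toReal h.ne]
      exact le_iSup (fun z => ENNReal.ofReal
        (‖fourierTransformMeasure μ z‖ ^ 2 * ‖z‖ ^ (s : ℝ))) z
    have hz' := norm_pos_iff.2 hz
    refine le_of_sq_le_sq ?_ (by positivity)
    rw [mul_pow, Real.sq_sqrt ENNReal.toReal_nonneg]
    calc ‖fourierTransformMeasure μ z‖ ^ 2
        = (‖fourierTransformMeasure μ z‖ ^ 2 * ‖z‖ ^ (s : ℝ)) * (‖z‖ ^ (-(s : ℝ) / 2)) ^ 2 := by
          rw [mul_assoc, mul_comm (‖z‖ ^ (s : ℝ)), hrpow z hz, mul_one]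
      _ ≤ _ := by gcongr
  · rintro ⟨C, hC⟩
    refine lt_of_le_of_lt (b := ENNReal.ofReal (max (C ^ 2)
      (‖fourierTransformMeasure μ 0‖ ^ 2 * ‖(0 : EuclideanSpace ℝ (Fin d))‖ ^ (s : ℝ))))
      (iSup_le fun z => ENNReal.ofReal_le_ofReal ?_) ENNReal.ofReal_lt_top
    rcases eq_or_ne z 0 with rfl | hz
    · exact le_max_right _ _
    · refine le_trans ?_ (le_max_left _ _)
      calc ‖fourierTransformMeasure μ z‖ ^ 2 * ‖z‖ ^ (s : ℝ)
          ≤ (C * ‖z‖ ^ (-(s : ℝ) / 2)) ^ 2 * ‖z‖ ^ (s : ℝ) := by gcongr; exact hC z hz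
        _ = C ^ 2 := by rw [mul_pow, mul_assoc, hrpow z hz, mul_one]

lemma fourierSpectrumSet_zero (X : Set (EuclideanSpace ℝ (Fin d))) :
    fourierSpectrumSet 0 X = fourierDimSet X := by
  refine iSup_congr fun μ => iSup_congr fun ⟨_, _⟩ => ?_
  congr 1
  exact iSup_congr fun s => iSup_congr_Prop (fourierEnergy_zero_lt_top_iff s μ) fun _ => rfl

/-- Since `J_{s,1}` is comparable with the Riesz energy only for `0 < s < d`, both inequalities are
proved for real numbers strictly below the supremum in question. -/
lemma fourierSpectrumSet_one (hd : 0 < d) {X : Set (EuclideanSpace ℝ (Fin d))}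
    (hX : MeasurableSet X) : fourierSpectrumSet 1 X = dimH X := by
  refine le_antisymm ?_ ?_
  · refine fourierSpectrumSet_le_of_forall fun μ _ hμ hX s hs => ?_
    refine le_of_forall_lt fun r hr => ?_
    obtain ⟨t, hrt, ht⟩ := ENNReal.lt_iff_exists_nnreal_btwn.1 hr
    refine hrt.trans_le ?_
    rcases eq_or_ne t 0 with rfl | h0
    · exact zero_le
    have ht0 : (0 : ℝ) < t := by exact_mod_cast pos_iff_ne_zero.2 h0
    have hts : t < s := by exact_mod_cast ht.trans_le (min_le_left _ _)
    have hts' : (t : ℝ) < s := by exact_mod_cast hts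
    have htd : (t : ℝ) < d := by exact_mod_cast ht.trans_le (min_le_right _ _)
    have h1 : fourierEnergy t 1 μ < ∞ := by
      rw [fourierEnergy_lt_top_iff hd ht0 one_pos]
      refine lt_of_le_of_lt (weightedFourierIntegral_mono ?_ μ)
        ((fourierEnergy_lt_top_iff hd (ht0.trans hts') one_pos μ).1 hs)
      simpa using hts'.le
    exact le_dimH_of_energy_lt_top (pos_iff_ne_zero.2 h0) hμ hX
      ((fourierEnergy_one_lt_top_iff ht0 htd μ).1 h1)
  · refine le_of_forall_lt fun r hr => ?_
    obtain ⟨t, hrt, ht⟩ := ENNReal.lt_iff_exists_nnreal_btwn.1 hr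
    refine hrt.trans_le ?_
    rcases eq_or_ne t 0 with rfl | h0
    · exact zero_le
    have htd : (t : ℝ≥0∞) < d := by
      refine ht.trans_le ((dimH_mono (subset_univ X)).trans (le_of_eq ?_))
      rw [Real.dimH_univ_eq_finrank, finrank_euclideanSpace_fin]
    have htd' : (t : ℝ) < d := by exact_mod_cast htd
    obtain ⟨μ, hfin, hμ, hμX, hE⟩ := exists_measure_energy_lt_top (pos_iff_ne_zero.2 h0) hX ht
    have h1 := (fourierEnergy_one_lt_top_iff (by exact_mod_cast pos_iff_ne_zero.2 h0) htd' μ).2 hE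
    exact le_trans (le_min le_rfl htd.le) (le_fourierSpectrumSet hμ hμX h1)

lemma lipschitzOnWith_fourierSpectrumSet (hd : 0 < d) (X : Set (EuclideanSpace ℝ (Fin d))) :
    LipschitzOnWith d (fun θ : ℝ => (fourierSpectrumSet θ X).toReal) (Icc 0 1) := by
  have hne : ∀ θ, fourierSpectrumSet θ X ≠ ∞ := fun θ =>
    ne_top_of_le_ne_top (ENNReal.natCast_ne_top d) (fourierSpectrumSet_le θ X)
  have key : ∀ θ ∈ Icc (0 : ℝ) 1, ∀ θ' ∈ Icc (0 : ℝ) 1, θ < θ' →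
      dist (fourierSpectrumSet θ X).toReal (fourierSpectrumSet θ' X).toReal ≤ d * dist θ θ' := by
    intro θ hθ θ' hθ' hlt
    have h1 := ENNReal.toReal_mono (hne θ') (fourierSpectrumSet_mono hd hθ.1 hlt X)
    have h2 := ENNReal.toReal_mono (ENNReal.add_ne_top.2 ⟨hne θ, ENNReal.ofReal_ne_top⟩)
      (fourierSpectrumSet_le_add hd hθ.1 hlt hθ'.2 X)
    rw [ENNReal.toReal_add (hne θ) ENNReal.ofReal_ne_top, ENNReal.toReal_ofReal
      (mul_nonneg (Nat.cast_nonneg d) (by linarith))] at h2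
    rw [dist_comm, Real.dist_eq, dist_comm, Real.dist_eq, abs_of_nonneg (by linarith),
      abs_of_pos (by linarith)]
    linarith
  refine LipschitzOnWith.of_dist_le_mul fun θ hθ θ' hθ' => ?_
  rcases lt_trichotomy θ θ' with h | rfl | h
  · exact key θ hθ θ' hθ' h
  · simp
  · rw [dist_comm, dist_comm θ]
    exact key θ' hθ' θ hθ h

end Spectrum

theorem theorem1p4 {d : ℕ} (X : Set (EuclideanSpace ℝ (Fin d))) (hX : X.Nonempty) :
    (∀ θ ∈ Icc (0 : ℝ) 1,
      fourierSpectrumSet θ X ≤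
        fourierDimSet X + (d : ℝ≥0∞) * (1 + fourierDimSet X / 2) * ENNReal.ofReal θ) ∧
    (∃ K : ℝ≥0, LipschitzOnWith K (fun θ : ℝ => (fourierSpectrumSet θ X).toReal) (Icc 0 1)) ∧
    fourierSpectrumSet 0 X = fourierDimSet X ∧
    (MeasurableSet X → fourierSpectrumSet 1 X = dimH X) := by
  rcases Nat.eq_zero_or_pos d with rfl | hd
  · -- in dimension zero every quantity vanishes
    have h0 : ∀ θ, fourierSpectrumSet θ X = 0 := fun θ =>
      le_antisymm (by simpa using fourierSpectrumSet_le θ X) zero_le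
    refine ⟨fun θ _ => by simp [h0], ⟨0, ?_⟩, fourierSpectrumSet_zero X, fun _ => ?_⟩
    · simp only [h0]
      exact (LipschitzWith.const 0).lipschitzOnWith
    · rw [h0, dimH_subsingleton (Set.subsingleton_of_subsingleton)]
  refine ⟨fun θ hθ => ?_, ⟨d, lipschitzOnWith_fourierSpectrumSet hd X⟩, fourierSpectrumSet_zero X,
    fourierSpectrumSet_one hd⟩
  rcases hθ.1.eq_or_lt with rfl | hθ0
  · rw [fourierSpectrumSet_zero]; exact le_self_add
  · calc fourierSpectrumSet θ X ≤ fourierSpectrumSet 0 X + ENNReal.ofReal (d * (θ - 0)) :=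
          fourierSpectrumSet_le_add hd le_rfl hθ0 hθ.2 X
      _ = fourierDimSet X + d * 1 * ENNReal.ofReal θ := by
          rw [fourierSpectrumSet_zero, sub_zero, ENNReal.ofReal_mul (Nat.cast_nonneg d),
            ENNReal.ofReal_natCast, mul_one]
      _ ≤ _ := by gcongr; exact le_self_add
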